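/- Let $X$ be a real $n\times p$ matrix with columns $x_1,\dots,x_p$, let $\Sigma=X'X/n$ with principal submatrices $\Sigma_A$, $A\subseteq\{1,\dots,p\}$, and let $\|\cdot\|$ be the Euclidean norm. Fix $\lambda>0$ and a penalty $\rho=\rho(\cdot\,;\lambda):[0,\infty)\to\mathbb R$ that is nondecreasing, continuous on $[0,\infty)$ and continuously differentiable on $(0,\infty)$, whose limit $\dot\rho(0+)$ exists and equals $\lambda$ whenever it is finite (otherwise it is $+\infty$). Suppose that $\dot\rho(t)=\dot\rho(1)+\int_1^t\ddot\rho(x)\,dx$ for all $t>0$, for a locally integrable function $\ddot\rho$ on $(0,\infty)$ that equals the derivative of $\dot\rho$ wherever this derivative exists. Suppose that the sparse convexity condition with rank $p$ holds: $$\kappa(\rho)\equiv\sup_{0<t_1<t_2}\frac{\dot\rho(t_1)-\dot\rho(t_2)}{t_2-t_1}<\min_{\emptyset\ne A,\ |A|\le p}c_{\min}(\Sigma_A),\qquad c_{\min}(\Sigma_A)=\min_{\|u\|=1}\|\Sigma_Au\| .$$ Then for every $y\in\mathbb R^n$ the penalized loss $(2n)^{-1}\|y-Xb\|^2+\sum_{j=1}^p\rho(|b_j|)$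 has a unique global minimizer $\widehat\beta=\widehat\beta(y)$ over $b\in\mathbb R^p$. Put $\widehat\mu=X\widehat\beta$, let $\widetilde\mu$ be the orthogonal projection of $y$ to the linear span of $x_1,\dots,x_p$, let $\widehat P$ be the matrix of the map $b\mapsto(b_j:\widehat\beta_j\neq0)$, and define $$Q=\Sigma_{\{j:\widehat\beta_j\ne0\}}+\mathrm{diag}\bigl(\ddot\rho(|\widehat\beta_j|):\widehat\beta_j\neq0\bigr),\qquad \widehat{\mathrm{df}}=\mathrm{trace}\bigl(Q^{-1}\widehat P\Sigma\widehat P'\bigr),\qquad \widehat C_p=\|\widetilde\mu-\widehat\mu\|^2+\widehat\sigma^2\bigl\{2\,\widehat{\mathrm{df}}-\mathrm{rank}(X)\bigr\}.$$ (a) Let $y=X\beta+\varepsilon$ with $\beta\in\mathbb R^p$ and $\varepsilon\sim N(0,\sigma^2I_n)$, $\sigma>0$; let $\mu=X\beta$ and $\mathrm{df}(\widehat\mu)=\sum_{i=1}^n\mathrm{Cov}(\widetilde\mu_i,\widehat\mu_i)/\sigma^2$. Then all the moments involved are finite ($\widetilde\mu_i$ and $\widehat\mu_i$ are square integrable, and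 $\widehat{\mathrm{df}}$, $\widehat C_p$ and $\|\widehat\mu-\mu\|^2$ are integrable), and $$E\,\widehat{\mathrm{df}}=\mathrm{df}(\widehat\mu),\qquad E\,\widehat C_p=E\|\widehat\mu-\mu\|^2,$$ where $\widehat\sigma^2$ is either $\sigma^2$ (known variance) or, when $p<n$ and $\Sigma$ is invertible (which is automatic if $\kappa(\rho)\ge0$), $\|y-X\widetilde\beta\|^2/(n-p)$ with the ordinary least squares estimator $\widetilde\beta=\Sigma^{-1}X'y/n$. (b) If $\rho(t)=\lambda t$ for all $t\ge0$ (the LASSO), then $\widehat{\mathrm{df}}=\#\{j:\widehat\beta_j\neq0\}$ for every $y\in\mathbb R^n$. (c) If, for some $\gamma>0$, $\dot\rho(t)=0$ for all $t\ge\gamma\lambda$ and $\dot\rho(0+)=\lambda$, then $\widehat{\mathrm{df}}=\#\{j:\widehat\beta_j\neq0\}$ for every $y\in\mathbb R^n$ such that $|\widehat\beta_j|>\gamma\lambda$ for all $j$ with $\widehat\beta_j\ne0$. -/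

import Mathlib

open MeasureTheory ProbabilityTheory Set Filter Topology

namespace PenLSE

noncomputable section

/-- Maximum concavity `κ(ρ) = sup_{0 < s < t} (ρ'(s) - ρ'(t)) / (t - s)`, an extended real. -/
def maxConcavity (ρ : ℝ → ℝ) : EReal :=
  ⨆ (s : ℝ) (t : ℝ) (_ : 0 < s ∧ s < t), (((deriv ρ s - deriv ρ t) / (t - s) : ℝ) : EReal)

/-- The standing assumptions on a penalty `ρ = ρ(·; lam)` on `[0, ∞)` and on its second derivative
`ρ₂`; the values of both functions at negative arguments play no role. -/
structure IsPenalty (ρ ρ₂ : ℝ → ℝ) (lam : ℝ) : Prop where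
  monotone : MonotoneOn ρ (Ici 0)
  continuous : ContinuousOn ρ (Ici 0)
  differentiable : DifferentiableOn ℝ ρ (Ioi 0)
  deriv_continuous : ContinuousOn (deriv ρ) (Ioi 0)
  /-- `ρ'(0+) = lam` whenever `ρ'(0+)` is finite. -/
  slope_zero : Tendsto (deriv ρ) (𝓝[>] 0) (𝓝 lam) ∨ Tendsto (deriv ρ) (𝓝[>] 0) atTop
  /-- `ρ'` is the indefinite integral of `ρ₂`. -/
  integrable : ∀ t, 0 < t → IntervalIntegrable ρ₂ volume 1 t
  deriv_eq : ∀ t, 0 < t → deriv ρ t = deriv ρ 1 + ∫ x in (1 : ℝ)..t, ρ₂ x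
  /-- `ρ₂` is the classical second derivative wherever that exists. -/
  second_deriv : ∀ t, 0 < t → DifferentiableAt ℝ (deriv ρ) t → ρ₂ t = deriv (deriv ρ) t

/-- `ρ'(t) = 0` for all `t ≥ γ lam`, and `ρ'(0+) = lam`. -/
def IsUnbiasedSelection (ρ : ℝ → ℝ) (γ lam : ℝ) : Prop :=
  (∀ t, γ * lam ≤ t → deriv ρ t = 0) ∧ Tendsto (deriv ρ) (𝓝[>] 0) (𝓝 lam)

variable {n p : ℕ}

/-- The linear predictor `X b`. -/
def fit (X : Matrix (Fin n) (Fin p) ℝ) (b : EuclideanSpace ℝ (Fin p)) :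
    EuclideanSpace ℝ (Fin n) :=
  X.toEuclideanLin b

/-- The normalized Gram matrix `Σ = X'X / n`. -/
def gram (X : Matrix (Fin n) (Fin p) ℝ) : Matrix (Fin p) (Fin p) ℝ :=
  (n : ℝ)⁻¹ • (X.transpose * X)

/-- The sub-Gram matrix `Σ_A`. -/
def subGram (X : Matrix (Fin n) (Fin p) ℝ) (A : Finset (Fin p)) : Matrix A A ℝ :=
  (gram X).submatrix Subtype.val Subtype.val

/-- `c_min(Σ_A) = min_{‖u‖ = 1} ‖Σ_A u‖` (and `⊤` for empty `A`). -/
def cMin (X : Matrix (Fin n) (Fin p) ℝ) (A : Finset (Fin p)) : EReal :=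
  ⨅ u : Metric.sphere (0 : EuclideanSpace ℝ A) 1,
    ((‖(subGram X A).toEuclideanLin (u : EuclideanSpace ℝ A)‖ : ℝ) : EReal)

/-- The sparse convexity condition with rank `d`: `κ(ρ) < min_{|A| ≤ d} c_min(Σ_A)`. -/
def SparseConvex (X : Matrix (Fin n) (Fin p) ℝ) (ρ : ℝ → ℝ) (d : ℕ) : Prop :=
  maxConcavity ρ < ⨅ (A : Finset (Fin p)) (_ : A.card ≤ d), cMin X A

/-- The penalized loss `L(b) = ‖y - X b‖² / (2n) + ∑ j, ρ(|b_j|)`. -/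
def penLoss (X : Matrix (Fin n) (Fin p) ℝ) (ρ : ℝ → ℝ) (y : EuclideanSpace ℝ (Fin n))
    (b : EuclideanSpace ℝ (Fin p)) : ℝ :=
  (2 * (n : ℝ))⁻¹ * ‖y - fit X b‖ ^ 2 + ∑ j, ρ |b j|

open Classical in
/-- The penalized least squares estimator `argmin_b L(b)` (a global minimizer, if there is one). -/
def betaHat (X : Matrix (Fin n) (Fin p) ℝ) (ρ : ℝ → ℝ) (y : EuclideanSpace ℝ (Fin n)) :
    EuclideanSpace ℝ (Fin p) :=
  if h : ∃ b, IsMinOn (penLoss X ρ y) univ b then h.choose else 0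

/-- `μ̂ = X β̂`. -/
def muHat (X : Matrix (Fin n) (Fin p) ℝ) (ρ : ℝ → ℝ) (y : EuclideanSpace ℝ (Fin n)) :
    EuclideanSpace ℝ (Fin n) :=
  fit X (betaHat X ρ y)

/-- `μ̃`, the orthogonal projection of `y` to the linear span of the columns of `X`. -/
def muTilde (X : Matrix (Fin n) (Fin p) ℝ) (y : EuclideanSpace ℝ (Fin n)) :
    EuclideanSpace ℝ (Fin n) :=
  (Submodule.span ℝ (range fun j : Fin p => WithLp.toLp 2 (X.col j))).starProjection y

/-- The ordinary least squares estimator `β̃ = Σ⁻¹ X'y / n`. -/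
def betaTilde (X : Matrix (Fin n) (Fin p) ℝ) (y : EuclideanSpace ℝ (Fin n)) :
    EuclideanSpace ℝ (Fin p) :=
  (gram X)⁻¹.toEuclideanLin ((n : ℝ)⁻¹ • X.transpose.toEuclideanLin y)

/-- The mean residual squares `‖y - X β̃‖² / (n - p)`. -/
def residualVariance (X : Matrix (Fin n) (Fin p) ℝ) (y : EuclideanSpace ℝ (Fin n)) : ℝ :=
  ‖y - fit X (betaTilde X y)‖ ^ 2 / ((n : ℝ) - (p : ℝ))

open Classical in
/-- `{j : b_j ≠ 0}`. -/
def active (b : EuclideanSpace ℝ (Fin p)) : Finset (Fin p) :=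
  Finset.univ.filter fun j => b j ≠ 0

/-- `Q(b) = Σ_{j : b_j ≠ 0} + diag(ρ₂(|b_j|), b_j ≠ 0)`. -/
def qMat (X : Matrix (Fin n) (Fin p) ℝ) (ρ₂ : ℝ → ℝ) (b : EuclideanSpace ℝ (Fin p)) :
    Matrix (active b) (active b) ℝ :=
  subGram X (active b) + Matrix.diagonal fun j => ρ₂ |b j.1|

/-- The matrix of the coordinate projection `v ↦ (v_j : b_j ≠ 0)`. -/
def projMat (b : EuclideanSpace ℝ (Fin p)) : Matrix (active b) (Fin p) ℝ :=
  (1 : Matrix (Fin p) (Fin p) ℝ).submatrix Subtype.val id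

/-- `df̂ = trace(Q⁻¹(β̂) P̂ Σ P̂')`. -/
def dfHat (X : Matrix (Fin n) (Fin p) ℝ) (ρ ρ₂ : ℝ → ℝ) (y : EuclideanSpace ℝ (Fin n)) : ℝ :=
  ((qMat X ρ₂ (betaHat X ρ y))⁻¹ *
    (projMat (betaHat X ρ y) * gram X * (projMat (betaHat X ρ y)).transpose)).trace

/-- `Ĉ_p = ‖μ̃ - μ̂‖² + σ̂² (2 df̂ - rank X)`, where `s` is the estimator `σ̂²`. -/
def cpHat (X : Matrix (Fin n) (Fin p) ℝ) (ρ ρ₂ : ℝ → ℝ) (s : EuclideanSpace ℝ (Fin n) → ℝ)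
    (y : EuclideanSpace ℝ (Fin n)) : ℝ :=
  ‖muTilde X y - muHat X ρ y‖ ^ 2 + s y * (2 * dfHat X ρ ρ₂ y - (X.rank : ℝ))

/-- Degrees of freedom `df(μ̂) = ∑ i, Cov(μ̃_i, μ̂_i) / σ²` when the data `y` live on `(Ω, P)`. -/
def degreesOfFreedom {Ω : Type*} [MeasurableSpace Ω] (P : Measure Ω)
    (X : Matrix (Fin n) (Fin p) ℝ) (ρ : ℝ → ℝ) (σ : ℝ) (y : Ω → EuclideanSpace ℝ (Fin n)) : ℝ :=
  ∑ i : Fin n, cov[fun ω => muTilde X (y ω) i, fun ω => muHat X ρ (y ω) i; P] / σ ^ 2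

end

end PenLSE

namespace PenLSE

/-! Choose reals `k < c` with `k` the maximum concavity and `c ≥ 0` a lower bound for the quadratic
form of the Gram matrix. Adding `k t² / 2` to the penalty makes it convex in `|t|` and
nondecreasing, hence convex on the whole line; the quadratic part of the loss pays for this with
modulus `c` (`IsPenalty.penLoss_midpoint_le`). The loss is thus uniformly convex with modulus `c -
k`. This gives existence, uniqueness and a Lipschitz minimizer `y ↦ β̂(y)`, which by Rademacher is
differentiable almost everywhere.

Differentiating the estimating equations at the nonzero coordinates gives a linear system with
matrix `Q`, and the trace of its solution identifies `df̂` with the divergence of `μ̂`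
(`dfHat_eq_sum`). The obstacle is a nonzero coordinate at a kink, a point where the slope of `ρ` is
not differentiable and `ρ₂` carries no pointwise information. Kinks form a null set, and since the
slope is an indefinite integral, so does their image under `ρ' + (k + 1) t`
(`IsPenalty.volume_image_kinks`). A function that takes values in a null set has zero gradient there
almost everywhere (`ae_fderiv_eq_zero_of_mem_null`). Applied to `β̂_j` and to the corresponding
score, this contradicts `k < c` (`notMem_kinks`), so almost surely no coordinate rests at a kink.

The rest is Stein's identity for Lipschitz functions (`integral_inner_mul_isoGaussian`): `E⟨ε, μ̂⟩`
is `σ²` times the expected divergence. It gives the covariance formula and, after expanding the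
squared error, the risk formula. With estimated variance, `β̂` depends on `y` only through its
projection to the column span, while the residual variance depends only on the orthogonal part, and
for Gaussian noise the two parts are independent. In the two selection statements `ρ₂` vanishes at
all nonzero coordinates, so `Q` is the sub-Gram matrix itself and the trace counts coordinates. -/

/-- The slope of `ρ` decreases at rate at most `k`, that is, `κ(ρ) ≤ k`. -/
def ConcavityLE (ρ : ℝ → ℝ) (k : ℝ) : Prop :=
  ∀ s t, 0 < s → s < t → deriv ρ s - deriv ρ t ≤ k * (t - s)

/-! ### Penalties of bounded concavity and the null set of their kinks -/

section Penalty

variable {ρ ρ₂ : ℝ → ℝ} {lam k : ℝ}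

lemma le_maxConcavity (ρ : ℝ → ℝ) {s t : ℝ} (hs : 0 < s) (hst : s < t) :
    (((deriv ρ s - deriv ρ t) / (t - s) : ℝ) : EReal) ≤ maxConcavity ρ :=
  le_iSup_of_le s <| le_iSup_of_le t <| le_iSup_of_le ⟨hs, hst⟩ le_rfl

lemma exists_coe_eq_maxConcavity (h : maxConcavity ρ < ⊤) : ∃ k : ℝ, maxConcavity ρ = k := by
  refine ⟨(maxConcavity ρ).toReal, (EReal.coe_toReal h.ne fun hb => ?_).symm⟩
  have := le_maxConcavity ρ one_pos one_lt_two
  rw [hb, le_bot_iff] at this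
  exact EReal.coe_ne_bot _ this

lemma concavityLE_of_maxConcavity_eq (h : maxConcavity ρ = k) : ConcavityLE ρ k := by
  intro s t hs hst
  have := le_maxConcavity ρ hs hst
  rw [h, EReal.coe_le_coe_iff, div_le_iff₀ (sub_pos.2 hst)] at this
  exact this

lemma ConcavityLE.monotoneOn (hk : ConcavityLE ρ k) :
    MonotoneOn (fun t => deriv ρ t + k * t) (Ioi 0) := by
  intro s hs t _ hst
  rcases hst.eq_or_lt with rfl | hst
  · exact le_rfl
  · have := hk s t hs hst
    simp only
    linarith

/-- A slope tending to infinity at zero would fall to `ρ'(1)` over a bounded interval, faster than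
rate `k` allows. -/
lemma IsPenalty.tendsto_deriv (hρ : IsPenalty ρ ρ₂ lam) (hk : ConcavityLE ρ k) :
    Tendsto (deriv ρ) (𝓝[>] 0) (𝓝 lam) := by
  refine hρ.slope_zero.resolve_right fun h => ?_
  have h1 : ∀ᶠ s : ℝ in 𝓝[>] 0, s ∈ Ioo (0 : ℝ) 1 := Ioo_mem_nhdsGT one_pos
  obtain ⟨s, hs, hs'⟩ := (h1.and (h.eventually_gt_atTop (deriv ρ 1 + |k|))).exists
  have := hk s 1 hs.1 hs.2
  have h2 : k * (1 - s) ≤ |k| * 1 :=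
    (mul_le_mul_of_nonneg_right (le_abs_self k) (by linarith [hs.2])).trans
      (mul_le_mul_of_nonneg_left (by linarith [hs.1]) (abs_nonneg k))
  linarith

/-- Monotonicity of `ρ' + k t`, compared with its limit at zero. For `k < 0` it bounds the slope
itself away from zero. -/
lemma IsPenalty.le_deriv_add (hρ : IsPenalty ρ ρ₂ lam) (hk : ConcavityLE ρ k) {t : ℝ}
    (ht : 0 < t) : lam ≤ deriv ρ t + k * t := by
  have h0 : Tendsto (fun s => deriv ρ s + k * s) (𝓝[>] 0) (𝓝 (lam + k * 0)) :=
    (hρ.tendsto_deriv hk).add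
      ((continuous_const.mul continuous_id).continuousAt.tendsto.mono_left nhdsWithin_le_nhds)
  have h1 : ∀ᶠ s : ℝ in 𝓝[>] 0, s ∈ Ioo (0 : ℝ) t := Ioo_mem_nhdsGT ht
  have := le_of_tendsto h0 (h1.mono fun s hs => hk.monotoneOn hs.1 ht hs.2.le)
  simpa using this

lemma IsPenalty.differentiableAt (hρ : IsPenalty ρ ρ₂ lam) {t : ℝ} (ht : 0 < t) :
    DifferentiableAt ℝ ρ t :=
  (hρ.differentiable t ht).differentiableAt (Ioi_mem_nhds ht)

lemma IsPenalty.hasDerivAt_add_sq (hρ : IsPenalty ρ ρ₂ lam) (k : ℝ) {t : ℝ} (ht : 0 < t) :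
    HasDerivAt (fun t => ρ t + k / 2 * t ^ 2) (deriv ρ t + k * t) t := by
  convert! (hρ.differentiableAt ht).hasDerivAt.add ((hasDerivAt_pow 2 t).const_mul (k / 2)) using 1
  simp; ring

lemma IsPenalty.continuousOn_add_sq (hρ : IsPenalty ρ ρ₂ lam) (k : ℝ) :
    ContinuousOn (fun t => ρ t + k / 2 * t ^ 2) (Ici 0) :=
  hρ.continuous.add (by fun_prop)

lemma IsPenalty.convexOn_add_sq (hρ : IsPenalty ρ ρ₂ lam) (hk : ConcavityLE ρ k) :
    ConvexOn ℝ (Ici 0) (fun t => ρ t + k / 2 * t ^ 2) := by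
  refine MonotoneOn.convexOn_of_deriv (convex_Ici 0) (hρ.continuousOn_add_sq k) ?_ ?_
  · rw [interior_Ici]
    exact fun t ht => (hρ.hasDerivAt_add_sq k ht).differentiableAt.differentiableWithinAt
  · rw [interior_Ici]
    exact hk.monotoneOn.congr fun t ht => (hρ.hasDerivAt_add_sq k ht).deriv.symm

lemma IsPenalty.monotoneOn_add_sq (hρ : IsPenalty ρ ρ₂ lam) (hlam : 0 < lam)
    (hk : ConcavityLE ρ k) : MonotoneOn (fun t => ρ t + k / 2 * t ^ 2) (Ici 0) := by
  refine monotoneOn_of_deriv_nonneg (convex_Ici 0) (hρ.continuousOn_add_sq k) ?_ ?_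
  · rw [interior_Ici]
    exact fun t ht => (hρ.hasDerivAt_add_sq k ht).differentiableAt.differentiableWithinAt
  · rw [interior_Ici]
    intro t ht
    rw [(hρ.hasDerivAt_add_sq k ht).deriv]
    exact hlam.le.trans (hρ.le_deriv_add hk ht)

/-- A convex nondecreasing function on the half-line stays convex after composition with `|·|`. The
monotonicity uses `lam > 0` and holds for either sign of `k`. -/
lemma IsPenalty.convexOn_abs_add_sq (hρ : IsPenalty ρ ρ₂ lam) (hlam : 0 < lam)
    (hk : ConcavityLE ρ k) : ConvexOn ℝ univ (fun t => ρ |t| + k / 2 * t ^ 2) := by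
  refine ⟨convex_univ, fun x _ y _ a b ha hb hab => ?_⟩
  have h1 : |a • x + b • y| ≤ a • |x| + b • |y| := by
    simp only [smul_eq_mul]
    exact (abs_add_le _ _).trans (by rw [abs_mul, abs_mul, abs_of_nonneg ha, abs_of_nonneg hb])
  have h2 := hρ.monotoneOn_add_sq hlam hk (abs_nonneg (a • x + b • y))
    (show a • |x| + b • |y| ∈ Ici (0 : ℝ) from (abs_nonneg _).trans h1) h1
  have h3 := (hρ.convexOn_add_sq hk).2 (abs_nonneg x) (abs_nonneg y) ha hb hab
  have h4 := h2.trans h3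
  simpa only [sq_abs] using h4

lemma IsPenalty.le_second_deriv (hρ : IsPenalty ρ ρ₂ lam) (hk : ConcavityLE ρ k) {t : ℝ}
    (ht : 0 < t) (hd : DifferentiableAt ℝ (deriv ρ) t) : -k ≤ ρ₂ t := by
  have h1 : HasDerivAt (fun t => deriv ρ t + k * t) (deriv (deriv ρ) t + k) t := by
    convert! hd.hasDerivAt.add ((hasDerivAt_id t).const_mul k) using 1
    simp
  have h2 : 0 ≤ derivWithin (fun t => deriv ρ t + k * t) (Ioi 0) t :=
    hk.monotoneOn.derivWithin_nonneg
  rw [derivWithin_of_isOpen isOpen_Ioi ht, h1.deriv] at h2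
  rw [hρ.second_deriv t ht hd]
  linarith

/-- The points in `(0, ∞)` at which the slope of `ρ` is not differentiable. -/
def kinks (ρ : ℝ → ℝ) : Set ℝ := {t | 0 < t ∧ ¬ DifferentiableAt ℝ (deriv ρ) t}

/-- Lebesgue's theorem for the monotone function `ρ' + k t`. -/
lemma ConcavityLE.volume_kinks (hk : ConcavityLE ρ k) : volume (kinks ρ) = 0 := by
  have h := hk.monotoneOn.ae_differentiableWithinAt_of_mem
  rw [measure_eq_zero_iff_ae_notMem]
  filter_upwards [h] with t ht hN
  have h1 := (ht hN.1).differentiableAt (Ioi_mem_nhds hN.1)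
  refine hN.2 ?_
  have h2 : DifferentiableAt ℝ (fun t => (deriv ρ t + k * t) - k * t) t :=
    h1.sub (by fun_prop)
  simpa using h2

/-- Slope `k + 1` instead of `k` makes the function injective, so that images of disjoint sets are
disjoint. -/
lemma ConcavityLE.strictMonoOn (hk : ConcavityLE ρ k) :
    StrictMonoOn (fun t => deriv ρ t + (k + 1) * t) (Ioi 0) := by
  intro s hs t _ hst
  have := hk s t hs hst
  simp only
  linarith

lemma IsPenalty.intervalIntegrable (hρ : IsPenalty ρ ρ₂ lam) {a b : ℝ} (ha : 0 < a)
    (hb : 0 < b) : IntervalIntegrable ρ₂ volume a b :=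
  (hρ.integrable a ha).symm.trans (hρ.integrable b hb)

lemma IsPenalty.integral_second_deriv (hρ : IsPenalty ρ ρ₂ lam) {a b : ℝ} (ha : 0 < a)
    (hb : 0 < b) : ∫ x in a..b, ρ₂ x = deriv ρ b - deriv ρ a := by
  rw [hρ.deriv_eq a ha, hρ.deriv_eq b hb,
    ← intervalIntegral.integral_add_adjacent_intervals (hρ.integrable a ha).symm
      (hρ.integrable b hb), intervalIntegral.integral_symm 1 a]
  ring

/-- An absolutely continuous increasing function maps null sets to null sets: by the area formula
the points of differentiability already fill the full length `G b - G a`, and the image of the kinks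
is disjoint from theirs. -/
lemma IsPenalty.volume_image_kinks_inter (hρ : IsPenalty ρ ρ₂ lam) (hk : ConcavityLE ρ k)
    {a b : ℝ} (ha : 0 < a) (hab : a ≤ b) :
    volume ((fun t => deriv ρ t + (k + 1) * t) '' (kinks ρ ∩ Icc a b)) = 0 := by
  set G : ℝ → ℝ := fun t => deriv ρ t + (k + 1) * t with hG
  have hb : 0 < b := ha.trans_le hab
  have hsub : Icc a b ⊆ Ioi (0 : ℝ) := fun t ht => ha.trans_le ht.1
  have hmono : StrictMonoOn G (Icc a b) := hk.strictMonoOn.mono hsub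
  have hcont : ContinuousOn G (Icc a b) :=
    (hρ.deriv_continuous.mono hsub).add (by fun_prop)
  -- A measurable null hull keeps the complement measurable without any claim about the kinks
  -- themselves.
  set N := toMeasurable volume (kinks ρ) with hN
  have hN0 : volume N = 0 := by rw [measure_toMeasurable]; exact hk.volume_kinks
  have hNm : MeasurableSet N := measurableSet_toMeasurable _ _
  set s := Icc a b \ N with hs
  have hsm : MeasurableSet s := measurableSet_Icc.diff hNm
  have hder : ∀ t ∈ s, HasDerivWithinAt G (ρ₂ t + (k + 1)) s t := by
    intro t ht
    have ht0 : 0 < t := hsub ht.1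
    have hd : DifferentiableAt ℝ (deriv ρ) t := by
      by_contra hd
      exact ht.2 (subset_toMeasurable _ _ ⟨ht0, hd⟩)
    have h1 : HasDerivAt (fun t => deriv ρ t + (k + 1) * t) (ρ₂ t + (k + 1)) t := by
      rw [hρ.second_deriv t ht0 hd]
      convert! hd.hasDerivAt.add ((hasDerivAt_id t).const_mul (k + 1)) using 1
      simp
    exact h1.hasDerivWithinAt
  have hvol := lintegral_deriv_eq_volume_image_of_monotoneOn hsm hder
    (hmono.mono sdiff_subset).monotoneOn
  have hint : IntegrableOn (fun t => ρ₂ t + (k + 1)) (Icc a b) := by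
    rw [integrableOn_Icc_iff_integrableOn_Ioc, ← intervalIntegrable_iff_integrableOn_Ioc_of_le hab]
    exact (hρ.intervalIntegrable ha hb).add intervalIntegrable_const
  have hae : s =ᵐ[volume] Icc a b := by
    rw [hs]; exact sdiff_null_ae_eq_self hN0
  have hnonneg : 0 ≤ᵐ[volume.restrict s] fun t => ρ₂ t + (k + 1) := by
    rw [EventuallyLE, ae_restrict_iff' hsm]
    refine Eventually.of_forall fun t ht => ?_
    have ht0 : 0 < t := hsub ht.1
    have hd : DifferentiableAt ℝ (deriv ρ) t := by
      by_contra hd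
      exact ht.2 (subset_toMeasurable _ _ ⟨ht0, hd⟩)
    have := hρ.le_second_deriv hk ht0 hd
    simp only [Pi.zero_apply]
    linarith
  -- The integral representation of `ρ'` enters here: it turns the integral of the derivative into
  -- the increment of `G`.
  rw [← ofReal_integral_eq_lintegral_ofReal (hint.mono_set sdiff_subset) hnonneg,
    setIntegral_congr_set hae, integral_Icc_eq_integral_Ioc,
    ← intervalIntegral.integral_of_le hab,
    intervalIntegral.integral_add (hρ.intervalIntegrable ha hb) intervalIntegrable_const,
    hρ.integral_second_deriv ha hb, intervalIntegral.integral_const] at hvol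
  have htot : deriv ρ b - deriv ρ a + (b - a) • (k + 1) = G b - G a := by
    simp only [hG, smul_eq_mul]; ring
  rw [htot] at hvol
  have himg : volume (G '' (Icc a b ∩ N)) = 0 := by
    have hdisj : Disjoint (G '' s) (G '' (Icc a b ∩ N)) := by
      rw [Set.disjoint_left]
      rintro _ ⟨t, ht, rfl⟩ ⟨u, hu, hut⟩
      rw [hmono.injOn hu.1 ht.1 hut] at hu
      exact ht.2 hu.2
    have hunion : G '' s ∪ G '' (Icc a b ∩ N) ⊆ Icc (G a) (G b) := by
      rw [← image_union, hs, sdiff_union_inter]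
      rintro _ ⟨t, ht, rfl⟩
      exact ⟨hmono.monotoneOn (left_mem_Icc.2 hab) ht ht.1,
        hmono.monotoneOn ht (right_mem_Icc.2 hab) ht.2⟩
    have hm : MeasurableSet (G '' s) :=
      hsm.image_of_continuousOn_injOn (hcont.mono sdiff_subset) (hmono.injOn.mono sdiff_subset)
    have hle : volume (G '' s) + volume (G '' (Icc a b ∩ N)) ≤ volume (G '' s) := by
      rw [← measure_union' hdisj hm]
      refine (measure_mono hunion).trans ?_
      rw [Real.volume_Icc, hvol]
    have hfin : volume (G '' s) ≠ ⊤ := by rw [← hvol]; exact ENNReal.ofReal_ne_top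
    by_contra h0
    exact absurd hle (not_le.2 (ENNReal.lt_add_right hfin h0))
  refine measure_mono_null (image_mono ?_) himg
  exact fun t ht => ⟨ht.2, subset_toMeasurable _ _ ht.1⟩

lemma IsPenalty.volume_image_kinks (hρ : IsPenalty ρ ρ₂ lam) (hk : ConcavityLE ρ k) :
    volume ((fun t => deriv ρ t + (k + 1) * t) '' kinks ρ) = 0 := by
  have h : kinks ρ ⊆ ⋃ m : ℕ, kinks ρ ∩ Icc (1 / ((m : ℝ) + 1)) (m + 1) := by
    intro t ht
    obtain ⟨m, hm⟩ := exists_nat_gt (max t (1 / t))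
    have ht0 : 0 < t := ht.1
    refine mem_iUnion.2 ⟨m, ht, ?_, ?_⟩
    · rw [one_div_le (by positivity) ht0]
      linarith [le_max_right t (1 / t)]
    · linarith [le_max_left t (1 / t)]
  refine measure_mono_null (image_mono h) ?_
  rw [image_iUnion]
  refine measure_iUnion_null fun m => hρ.volume_image_kinks_inter hk (by positivity) ?_
  rw [div_le_iff₀ (by positivity)]
  nlinarith [(Nat.cast_nonneg m : (0 : ℝ) ≤ m)]

end Penalty

end PenLSE

/-! ### Lower bounds for the Gram matrix -/

namespace PenLSE

open scoped RealInnerProductSpace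

/-- A positive symmetric operator that expands norms by `c` is bounded below by `c`. -/
lemma _root_.LinearMap.IsSymmetric.mul_norm_sq_le_inner {E : Type*} [NormedAddCommGroup E]
    [InnerProductSpace ℝ E] [FiniteDimensional ℝ E] {T : E →ₗ[ℝ] E} (hT : T.IsSymmetric)
    (hpos : ∀ u, 0 ≤ ⟪T u, u⟫) {c : ℝ} (hc : ∀ u, c * ‖u‖ ≤ ‖T u‖) (u : E) :
    c * ‖u‖ ^ 2 ≤ ⟪T u, u⟫ := by
  set b := hT.eigenvectorBasis rfl with hb
  have hTb : ∀ i, T (b i) = hT.eigenvalues rfl i • b i := fun i =>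
    hT.apply_eigenvectorBasis rfl i
  -- The norm bound controls only the absolute values of the eigenvalues; positivity removes the
  -- sign ambiguity.
  have hev : ∀ i, c ≤ hT.eigenvalues rfl i := by
    intro i
    have h1 : 0 ≤ hT.eigenvalues rfl i := by
      have := hpos (b i)
      rwa [hTb, real_inner_smul_left, real_inner_self_eq_norm_sq, b.norm_eq_one, one_pow,
        mul_one] at this
    have := hc (b i)
    rwa [hTb, norm_smul, b.norm_eq_one, mul_one, mul_one, Real.norm_of_nonneg h1] at this
  have h1 : ⟪T u, u⟫ = ∑ i, hT.eigenvalues rfl i * ⟪b i, u⟫ ^ 2 := by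
    rw [← b.sum_inner_mul_inner]
    refine Finset.sum_congr rfl fun i _ => ?_
    rw [hT u (b i), hTb, real_inner_smul_right, real_inner_comm u (b i)]
    ring
  rw [h1, ← b.sum_sq_inner_right, Finset.mul_sum]
  exact Finset.sum_le_sum fun i _ => mul_le_mul_of_nonneg_right (hev i) (sq_nonneg _)

section Design

variable {n p : ℕ} (X : Matrix (Fin n) (Fin p) ℝ)

/-- The `j`-th column of `X` as a Euclidean vector. -/
noncomputable def colVec (j : Fin p) : EuclideanSpace ℝ (Fin n) := WithLp.toLp 2 (X.col j)

/-- `fit X` as a continuous linear map. -/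
noncomputable def fitL : EuclideanSpace ℝ (Fin p) →L[ℝ] EuclideanSpace ℝ (Fin n) :=
  X.toEuclideanLin.toContinuousLinearMap

lemma fit_eq_fitL (b : EuclideanSpace ℝ (Fin p)) : fit X b = fitL X b := rfl

lemma fitL_single (j : Fin p) : fitL X (EuclideanSpace.single j 1) = colVec X j := by
  ext i
  simp [fitL, colVec, Matrix.toLpLin_apply]

lemma fitL_eq_sum (b : EuclideanSpace ℝ (Fin p)) : fitL X b = ∑ j, b j • colVec X j := by
  ext i
  simp [fitL, colVec, Matrix.toLpLin_apply, Matrix.mulVec, dotProduct, mul_comm]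

lemma inner_colVec_colVec (i j : Fin p) : (n : ℝ)⁻¹ * ⟪colVec X i, colVec X j⟫ = gram X i j := by
  simp [colVec, gram, Matrix.mul_apply, PiLp.inner_apply, mul_comm]

lemma inner_gram (u v : EuclideanSpace ℝ (Fin p)) :
    ⟪(gram X).toEuclideanLin u, v⟫ = (n : ℝ)⁻¹ * ⟪fitL X u, fitL X v⟫ := by
  simp only [gram, fitL, LinearMap.coe_toContinuousLinearMap', map_smul, LinearMap.smul_apply,
    real_inner_smul_left]
  congr 1
  simp only [Matrix.toLpLin_apply, PiLp.inner_apply, RCLike.inner_apply, conj_trivial]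
  have := Matrix.dotProduct_mulVec v.ofLp X.transpose (X.mulVec u.ofLp)
  rw [Matrix.mulVec_mulVec, Matrix.vecMul_transpose] at this
  simpa [dotProduct] using this

lemma gram_isSymmetric :
    ((gram X).toEuclideanLin : EuclideanSpace ℝ (Fin p) →ₗ[ℝ] _).IsSymmetric := by
  intro u v
  rw [inner_gram, real_inner_comm _ u, inner_gram, real_inner_comm]

/-- `c_min(Σ) ≥ c`, as a bound for the quadratic form of `Σ`. -/
def GramGE (c : ℝ) : Prop :=
  ∀ b : EuclideanSpace ℝ (Fin p), c * ‖b‖ ^ 2 ≤ (n : ℝ)⁻¹ * ‖fitL X b‖ ^ 2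

variable {X}

lemma norm_subGram_univ (u : EuclideanSpace ℝ (Fin p)) :
    ‖(subGram X Finset.univ).toEuclideanLin
        (WithLp.toLp 2 fun i : (Finset.univ : Finset (Fin p)) => u i)‖ =
      ‖(gram X).toEuclideanLin u‖ := by
  rw [EuclideanSpace.norm_eq, EuclideanSpace.norm_eq]
  congr 1
  rw [← Finset.sum_coe_sort Finset.univ fun i => ‖(gram X).toEuclideanLin u i‖ ^ 2]
  refine Finset.sum_congr rfl fun i _ => ?_
  simp only [Matrix.toLpLin_apply, Matrix.mulVec, dotProduct, subGram, Matrix.submatrix_apply]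
  rw [Finset.sum_coe_sort Finset.univ fun j => gram X i j * u j]

lemma norm_restrict_univ (u : EuclideanSpace ℝ (Fin p)) :
    ‖(WithLp.toLp 2 fun i : (Finset.univ : Finset (Fin p)) => u i :
      EuclideanSpace ℝ (Finset.univ : Finset (Fin p)))‖ = ‖u‖ := by
  rw [EuclideanSpace.norm_eq, EuclideanSpace.norm_eq]
  congr 1
  exact Finset.sum_coe_sort Finset.univ fun i => ‖u i‖ ^ 2

lemma gramGE_of_lt_cMin {c : ℝ} (hc : (c : EReal) < cMin X Finset.univ) : GramGE X c := by
  intro b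
  rw [← real_inner_self_eq_norm_sq (fitL X b), ← inner_gram]
  refine (gram_isSymmetric X).mul_norm_sq_le_inner (fun u => ?_) (fun u => ?_) b
  · rw [inner_gram]
    exact mul_nonneg (by positivity) real_inner_self_nonneg
  · rcases eq_or_ne u 0 with rfl | hu
    · simp
    set w : EuclideanSpace ℝ (Finset.univ : Finset (Fin p)) := WithLp.toLp 2 fun i => u i with hw
    have hwn : ‖w‖ = ‖u‖ := norm_restrict_univ u
    have hu' : 0 < ‖u‖ := norm_pos_iff.2 hu
    have h1 : ‖(‖u‖⁻¹ • w)‖ = 1 := by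
      rw [norm_smul, hwn, norm_inv, norm_norm, inv_mul_cancel₀ hu'.ne']
    have h2 := hc.le.trans (iInf_le _ (⟨‖u‖⁻¹ • w, by simpa using h1⟩ : Metric.sphere _ _))
    simp only [map_smul, norm_smul, norm_inv, norm_norm] at h2
    rw [EReal.coe_le_coe_iff, hw, norm_subGram_univ, inv_mul_eq_div, le_div_iff₀ hu'] at h2
    exact h2

lemma gramGE_zero : GramGE X 0 := fun b => by
  rw [zero_mul]; positivity

/-- The sparse convexity condition in terms of real bounds for `κ(ρ)` and the form of `Σ`. -/
lemma SparseConvex.exists_bounds {ρ : ℝ → ℝ} (h : SparseConvex X ρ p) :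
    ∃ k c : ℝ, maxConcavity ρ = k ∧ k < c ∧ 0 ≤ c ∧ GramGE X c := by
  have h1 : maxConcavity ρ < cMin X Finset.univ :=
    h.trans_le (iInf₂_le Finset.univ (by simp))
  obtain ⟨k, hk⟩ := exists_coe_eq_maxConcavity (h1.trans_le le_top)
  rw [hk] at h1
  obtain ⟨c, hkc, hc⟩ := EReal.lt_iff_exists_real_btwn.1 h1
  -- Truncation at zero is free because the Gram form is nonnegative; the sign of `c` matters later
  -- when `k < 0` and the Gram matrix may be singular.
  refine ⟨k, max c 0, hk, (EReal.coe_lt_coe_iff.1 hkc).trans_le (le_max_left _ _),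
    le_max_right _ _, ?_⟩
  rcases max_choice c 0 with h | h <;> rw [h]
  exacts [gramGE_of_lt_cMin hc, gramGE_zero]

end Design

/-! ### Uniform convexity of the loss and the Lipschitz minimizer -/

section Loss

variable {n p : ℕ} {X : Matrix (Fin n) (Fin p) ℝ} {ρ ρ₂ : ℝ → ℝ} {lam k c : ℝ}

/-- The penalty and the quadratic term in `b` cancel, leaving an affine function of `b`. Stability
in the data reduces to this. -/
lemma penLoss_sub_penLoss (y y' : EuclideanSpace ℝ (Fin n)) (b : EuclideanSpace ℝ (Fin p)) :
    penLoss X ρ y b - penLoss X ρ y' b =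
      (2 * (n : ℝ))⁻¹ * (‖y‖ ^ 2 - ‖y'‖ ^ 2) - (n : ℝ)⁻¹ * ⟪y - y', fitL X b⟫ := by
  simp only [penLoss, fit_eq_fitL, norm_sub_sq_real, inner_sub_left, mul_inv]
  ring

lemma IsPenalty.convexOn_sum (hρ : IsPenalty ρ ρ₂ lam) (hlam : 0 < lam) (hk : ConcavityLE ρ k) :
    ConvexOn ℝ univ fun b : EuclideanSpace ℝ (Fin p) => ∑ j, (ρ |b j| + k / 2 * b j ^ 2) := by
  have := hρ.convexOn_abs_add_sq hlam hk
  refine ⟨convex_univ, fun x _ y _ a b ha hb hab => ?_⟩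
  simp only [Finset.smul_sum, ← Finset.sum_add_distrib]
  exact Finset.sum_le_sum fun j _ => this.2 (mem_univ (x j)) (mem_univ (y j)) ha hb hab

lemma IsPenalty.continuous_sum (hρ : IsPenalty ρ ρ₂ lam) :
    Continuous fun b : EuclideanSpace ℝ (Fin p) => ∑ j, ρ |b j| := by
  refine continuous_finsetSum _ fun j _ => ?_
  exact hρ.continuous.comp_continuous (by fun_prop) fun b => mem_Ici.2 (abs_nonneg _)

lemma IsPenalty.continuous_penLoss (hρ : IsPenalty ρ ρ₂ lam) (y : EuclideanSpace ℝ (Fin n)) :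
    Continuous (penLoss X ρ y) := by
  have := hρ.continuous_sum (p := p)
  unfold penLoss
  simp only [fit_eq_fitL]
  fun_prop

/-- The uniform convexity of the penalized loss, at midpoints. -/
lemma IsPenalty.penLoss_midpoint_le (hρ : IsPenalty ρ ρ₂ lam) (hlam : 0 < lam)
    (hk : ConcavityLE ρ k) (hc : GramGE X c) (y : EuclideanSpace ℝ (Fin n))
    (b b' : EuclideanSpace ℝ (Fin p)) :
    penLoss X ρ y ((1 / 2 : ℝ) • b + (1 / 2 : ℝ) • b') + (c - k) / 8 * ‖b - b'‖ ^ 2 ≤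
      (penLoss X ρ y b + penLoss X ρ y b') / 2 := by
  have h1 := (hρ.convexOn_sum (p := p) hlam hk).2 (mem_univ b) (mem_univ b')
    (by norm_num : (0 : ℝ) ≤ 1 / 2) (by norm_num : (0 : ℝ) ≤ 1 / 2) (by norm_num)
  have hid : ∀ {E : Type} [NormedAddCommGroup E] [InnerProductSpace ℝ E] (u v : E),
      ‖(1 / 2 : ℝ) • u + (1 / 2 : ℝ) • v‖ ^ 2 =
        (‖u‖ ^ 2 + ‖v‖ ^ 2) / 2 - ‖u - v‖ ^ 2 / 4 := by
    intro E _ _ u v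
    rw [← smul_add, norm_smul, mul_pow, norm_add_sq_real, norm_sub_sq_real]
    norm_num
    ring
  have h2 : ∀ b : EuclideanSpace ℝ (Fin p),
      ∑ j, (ρ |b j| + k / 2 * b j ^ 2) = (∑ j, ρ |b j|) + k / 2 * ‖b‖ ^ 2 := by
    intro b
    rw [Finset.sum_add_distrib, ← Finset.mul_sum, EuclideanSpace.real_norm_sq_eq]
  simp only [h2] at h1
  rw [hid] at h1
  have h3 := hc (b - b')
  have h4 : y - fitL X ((1 / 2 : ℝ) • b + (1 / 2 : ℝ) • b') =
      (1 / 2 : ℝ) • (y - fitL X b) + (1 / 2 : ℝ) • (y - fitL X b') := by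
    rw [map_add, map_smul, map_smul]; module
  have h5 : (y - fitL X b) - (y - fitL X b') = -(fitL X (b - b')) := by
    rw [map_sub]; abel
  simp only [penLoss, fit_eq_fitL]
  rw [h4, hid, h5, norm_neg]
  simp only [smul_eq_mul] at h1
  rw [mul_inv]
  nlinarith

lemma IsPenalty.sub_le_penLoss (hρ : IsPenalty ρ ρ₂ lam) (hlam : 0 < lam)
    (hk : ConcavityLE ρ k) (hc : GramGE X c) (y : EuclideanSpace ℝ (Fin n))
    (b : EuclideanSpace ℝ (Fin p)) :
    (c - k) / 2 * ‖b‖ ^ 2 - (n : ℝ)⁻¹ * (‖y‖ * ‖fitL X‖) * ‖b‖ + p * ρ 0 ≤ penLoss X ρ y b := by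
  have h1 : p * ρ 0 ≤ (∑ j, ρ |b j|) + k / 2 * ‖b‖ ^ 2 := by
    rw [EuclideanSpace.real_norm_sq_eq, Finset.mul_sum, ← Finset.sum_add_distrib]
    calc (p : ℝ) * ρ 0 = ∑ j : Fin p, ρ 0 := by simp
      _ ≤ _ := Finset.sum_le_sum fun j _ => by
        have := hρ.monotoneOn_add_sq hlam hk (mem_Ici.2 le_rfl) (abs_nonneg (b j)) (abs_nonneg _)
        simpa using this
  have h2 := hc b
  have h3 : ⟪y, fitL X b⟫ ≤ ‖y‖ * ‖fitL X‖ * ‖b‖ := by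
    rw [mul_assoc]
    exact (real_inner_le_norm _ _).trans
      (mul_le_mul_of_nonneg_left ((fitL X).le_opNorm b) (norm_nonneg _))
  have h4 : (n : ℝ)⁻¹ * ⟪y, fitL X b⟫ ≤ (n : ℝ)⁻¹ * (‖y‖ * ‖fitL X‖ * ‖b‖) :=
    mul_le_mul_of_nonneg_left h3 (by positivity)
  have h5 : 0 ≤ (n : ℝ)⁻¹ * ‖y‖ ^ 2 := by positivity
  simp only [penLoss, fit_eq_fitL]
  rw [norm_sub_sq_real, mul_inv]
  nlinarith

lemma IsPenalty.exists_isMinOn (hρ : IsPenalty ρ ρ₂ lam) (hlam : 0 < lam)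
    (hk : ConcavityLE ρ k) (hc : GramGE X c) (hkc : k < c) (y : EuclideanSpace ℝ (Fin n)) :
    ∃ b, IsMinOn (penLoss X ρ y) univ b := by
  set A := (n : ℝ)⁻¹ * (‖y‖ * ‖fitL X‖)
  have h1 : Tendsto (fun t : ℝ => (c - k) / 2 * t ^ 2 - A * t + p * ρ 0) atTop atTop := by
    have h2 : Tendsto (fun t : ℝ => t * ((c - k) / 2 * t - A)) atTop atTop :=
      tendsto_id.atTop_mul_atTop₀ (tendsto_atTop_add_const_right _ _
        (tendsto_id.const_mul_atTop (by linarith)))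
    refine (tendsto_atTop_add_const_right _ (p * ρ 0) h2).congr fun t => by ring
  have h2 : Tendsto (penLoss X ρ y) (cocompact _) atTop :=
    tendsto_atTop_mono (hρ.sub_le_penLoss hlam hk hc y)
      (h1.comp tendsto_norm_cocompact_atTop)
  obtain ⟨b, hb⟩ := (hρ.continuous_penLoss y).exists_forall_le h2
  exact ⟨b, fun x _ => hb x⟩

lemma IsPenalty.isMinOn_betaHat (hρ : IsPenalty ρ ρ₂ lam) (hlam : 0 < lam)
    (hk : ConcavityLE ρ k) (hc : GramGE X c) (hkc : k < c) (y : EuclideanSpace ℝ (Fin n)) :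
    IsMinOn (penLoss X ρ y) univ (betaHat X ρ y) := by
  have h := hρ.exists_isMinOn hlam hk hc hkc y
  rw [betaHat, dif_pos h]
  exact h.choose_spec

/-- Quadratic growth away from the minimizer, obtained by comparing its value with the one at the
midpoint. -/
lemma IsPenalty.add_le_penLoss_of_isMinOn (hρ : IsPenalty ρ ρ₂ lam) (hlam : 0 < lam)
    (hk : ConcavityLE ρ k) (hc : GramGE X c) {y : EuclideanSpace ℝ (Fin n)}
    {b : EuclideanSpace ℝ (Fin p)} (hb : IsMinOn (penLoss X ρ y) univ b)
    (b' : EuclideanSpace ℝ (Fin p)) :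
    penLoss X ρ y b + (c - k) / 4 * ‖b' - b‖ ^ 2 ≤ penLoss X ρ y b' := by
  have h1 := hρ.penLoss_midpoint_le hlam hk hc y b' b
  have h2 := hb (mem_univ ((1 / 2 : ℝ) • b' + (1 / 2 : ℝ) • b))
  simp only [mem_ofPred_eq] at h2
  linarith

lemma IsPenalty.isMinOn_iff (hρ : IsPenalty ρ ρ₂ lam) (hlam : 0 < lam)
    (hk : ConcavityLE ρ k) (hc : GramGE X c) (hkc : k < c) (y : EuclideanSpace ℝ (Fin n))
    (b : EuclideanSpace ℝ (Fin p)) :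
    IsMinOn (penLoss X ρ y) univ b ↔ b = betaHat X ρ y := by
  refine ⟨fun hb => ?_, fun h => h ▸ hρ.isMinOn_betaHat hlam hk hc hkc y⟩
  have h1 := hρ.add_le_penLoss_of_isMinOn hlam hk hc (hρ.isMinOn_betaHat hlam hk hc hkc y) b
  have h2 : penLoss X ρ y b ≤ penLoss X ρ y (betaHat X ρ y) := hb (mem_univ _)
  have h3 : ‖b - betaHat X ρ y‖ ^ 2 ≤ 0 := by
    by_contra h
    nlinarith [mul_pos (sub_pos.2 hkc) (not_le.1 h)]
  rw [← sub_eq_zero, ← norm_eq_zero]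
  exact pow_eq_zero_iff two_ne_zero |>.1 (le_antisymm h3 (sq_nonneg _))

/-- Adding the growth inequalities at `y` and at `y'` bounds the squared distance of the minimizers
by an inner product that is linear in their difference. -/
lemma IsPenalty.norm_betaHat_sub_le (hρ : IsPenalty ρ ρ₂ lam) (hlam : 0 < lam)
    (hk : ConcavityLE ρ k) (hc : GramGE X c) (hkc : k < c) (y y' : EuclideanSpace ℝ (Fin n)) :
    ‖betaHat X ρ y - betaHat X ρ y'‖ ≤
      2 / (c - k) * ((n : ℝ)⁻¹ * ‖fitL X‖) * ‖y - y'‖ := by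
  have h1 := hρ.add_le_penLoss_of_isMinOn hlam hk hc
    (hρ.isMinOn_betaHat hlam hk hc hkc y) (betaHat X ρ y')
  have h2 := hρ.add_le_penLoss_of_isMinOn hlam hk hc
    (hρ.isMinOn_betaHat hlam hk hc hkc y') (betaHat X ρ y)
  have h3 := penLoss_sub_penLoss (X := X) (ρ := ρ) y y' (betaHat X ρ y)
  have h4 := penLoss_sub_penLoss (X := X) (ρ := ρ) y y' (betaHat X ρ y')
  set b := betaHat X ρ y
  set b' := betaHat X ρ y'
  rw [norm_sub_rev] at h1
  have h5 : (n : ℝ)⁻¹ * ⟪y - y', fitL X b⟫ - (n : ℝ)⁻¹ * ⟪y - y', fitL X b'⟫ ≤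
      (n : ℝ)⁻¹ * (‖y - y'‖ * (‖fitL X‖ * ‖b - b'‖)) := by
    rw [← mul_sub, ← inner_sub_right, ← map_sub]
    refine mul_le_mul_of_nonneg_left ?_ (by positivity)
    exact (real_inner_le_norm _ _).trans
      (mul_le_mul_of_nonneg_left ((fitL X).le_opNorm _) (norm_nonneg _))
  have hm : 0 < c - k := sub_pos.2 hkc
  have h6 : (c - k) / 2 * ‖b - b'‖ ^ 2 ≤ (n : ℝ)⁻¹ * (‖y - y'‖ * (‖fitL X‖ * ‖b - b'‖)) := by
    linarith
  rcases (norm_nonneg (b - b')).eq_or_lt with h0 | h0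
  · rw [← h0]; positivity
  have h7 : (c - k) / 2 * ‖b - b'‖ ≤ (n : ℝ)⁻¹ * (‖y - y'‖ * ‖fitL X‖) := by
    refine le_of_mul_le_mul_right ?_ h0
    linarith
  rw [div_mul_eq_mul_div, div_mul_eq_mul_div, le_div_iff₀ hm]
  linarith

lemma IsPenalty.exists_lipschitzWith_betaHat (hρ : IsPenalty ρ ρ₂ lam) (hlam : 0 < lam)
    (hk : ConcavityLE ρ k) (hc : GramGE X c) (hkc : k < c) :
    ∃ K, LipschitzWith K (betaHat X ρ) := by
  have hm : 0 < c - k := sub_pos.2 hkc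
  refine ⟨⟨2 / (c - k) * ((n : ℝ)⁻¹ * ‖fitL X‖), by positivity⟩,
    LipschitzWith.of_dist_le_mul fun y y' => ?_⟩
  rw [dist_eq_norm, dist_eq_norm]
  exact hρ.norm_betaHat_sub_le hlam hk hc hkc y y'

/-- The estimating equation at a nonzero coordinate of the minimizer. -/
lemma IsPenalty.sign_mul_deriv_eq (hρ : IsPenalty ρ ρ₂ lam) {y : EuclideanSpace ℝ (Fin n)}
    {b : EuclideanSpace ℝ (Fin p)} (hb : IsMinOn (penLoss X ρ y) univ b) {j : Fin p}
    (hj : b j ≠ 0) :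
    SignType.sign (b j) * deriv ρ |b j| = (n : ℝ)⁻¹ * ⟪colVec X j, y - fitL X b⟫ := by
  set e : EuclideanSpace ℝ (Fin p) := EuclideanSpace.single j 1 with he
  have hγ : ∀ t : ℝ, penLoss X ρ y (b + t • e) =
      (2 * (n : ℝ))⁻¹ * ‖(y - fitL X b) - t • colVec X j‖ ^ 2 +
        (ρ |b j + t| + ∑ i ∈ Finset.univ.erase j, ρ |b i|) := by
    intro t
    simp only [penLoss, fit_eq_fitL, map_add, map_smul, he, fitL_single]
    congr 1
    · rw [sub_sub]
    · rw [← Finset.add_sum_erase _ _ (Finset.mem_univ j)]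
      congr 1
      · simp
      · refine Finset.sum_congr rfl fun i hi => ?_
        simp [Finset.ne_of_mem_erase hi]
  have h1 : HasDerivAt (fun t : ℝ => (2 * (n : ℝ))⁻¹ * ‖(y - fitL X b) - t • colVec X j‖ ^ 2)
      ((2 * (n : ℝ))⁻¹ * (2 * ⟪y - fitL X b, -colVec X j⟫)) 0 := by
    have h := (((hasDerivAt_id (0 : ℝ)).smul_const (colVec X j)).const_sub (y - fitL X b)).norm_sq
    refine (h.const_mul _).congr_deriv ?_
    simp
  have h2 : HasDerivAt (fun t : ℝ => ρ |b j + t|) (deriv ρ |b j| * SignType.sign (b j)) 0 := by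
    have ha : HasDerivAt (fun t : ℝ => |b j + t|) (SignType.sign (b j) : ℝ) 0 := by
      have h := (hasDerivAt_abs hj)
      have h' : HasDerivAt (fun t : ℝ => b j + t) 1 0 := (hasDerivAt_id 0).const_add _
      rw [show b j = b j + 0 by simp] at h
      exact (h.comp (0 : ℝ) h').congr_deriv (by simp)
    have hr : HasDerivAt ρ (deriv ρ |b j|) |b j + 0| := by
      rw [add_zero]; exact (hρ.differentiableAt (abs_pos.2 hj)).hasDerivAt
    exact hr.comp (0 : ℝ) ha
  have h3 := h1.add (h2.add_const (∑ i ∈ Finset.univ.erase j, ρ |b i|))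
  have h4 : IsLocalMin (fun t : ℝ => (2 * (n : ℝ))⁻¹ * ‖(y - fitL X b) - t • colVec X j‖ ^ 2 +
        (ρ |b j + t| + ∑ i ∈ Finset.univ.erase j, ρ |b i|)) 0 := by
    refine Eventually.of_forall fun t => ?_
    have := hb (mem_univ (b + t • e))
    simp only [mem_ofPred_eq] at this
    rw [hγ] at this
    have h0 := hγ 0
    rw [zero_smul, add_zero] at h0
    rwa [h0] at this
  have h5 := h4.hasDerivAt_eq_zero h3
  rw [inner_neg_right, real_inner_comm, mul_inv] at h5
  linarith

/-- Data differing by a vector orthogonal to the range of `X` give losses that differ by a constant,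
hence the same minimizer. -/
lemma IsPenalty.betaHat_eq_of_inner_eq (hρ : IsPenalty ρ ρ₂ lam) (hlam : 0 < lam)
    (hk : ConcavityLE ρ k) (hc : GramGE X c) (hkc : k < c) {y y' : EuclideanSpace ℝ (Fin n)}
    (h : ∀ b, ⟪y - y', fitL X b⟫ = 0) : betaHat X ρ y = betaHat X ρ y' := by
  rw [← hρ.isMinOn_iff hlam hk hc hkc y']
  intro b _
  have h1 := hρ.isMinOn_betaHat hlam hk hc hkc y (mem_univ b)
  have h2 := penLoss_sub_penLoss (X := X) (ρ := ρ) y y' b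
  have h3 := penLoss_sub_penLoss (X := X) (ρ := ρ) y y' (betaHat X ρ y)
  rw [h] at h2 h3
  simp only [mem_ofPred_eq] at h1 ⊢
  linarith

end Loss

end PenLSE

/-! ### Gradients of functions on preimages of null sets -/

namespace PenLSE

open scoped ENNReal NNReal

/-- A map with invertible derivatives on `s` and with a null image of `s` can only do so
on a null set `s`. -/
lemma addHaar_eq_zero_of_addHaar_image_eq_zero {E : Type*} [NormedAddCommGroup E]
    [NormedSpace ℝ E] [FiniteDimensional ℝ E] [MeasurableSpace E] [BorelSpace E]
    (μ : Measure E) [μ.IsAddHaarMeasure] {f : E → E} {s : Set E} {f' : E → E →L[ℝ] E}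
    (hf' : ∀ x ∈ s, HasFDerivWithinAt f (f' x) s x) (hdet : ∀ x ∈ s, (f' x).det ≠ 0)
    (h : μ (f '' s) = 0) : μ s = 0 := by
  rcases s.eq_empty_or_nonempty with rfl | hs
  · simp
  -- Maps close to an invertible `A` expand measure at least by some `m > 0`. The dummy `m = 0` for
  -- singular `A` is never used, since each piece of the partition has its `A` among the
  -- derivatives.
  have hr : ∀ A : E →L[ℝ] E, ∃ (m δ : ℝ≥0), 0 < δ ∧ (A.det ≠ 0 → m ≠ 0) ∧
      ∀ (s : Set E) (f : E → E), ApproximatesLinearOn f A s δ → (m : ℝ≥0∞) * μ s ≤ μ (f '' s) := by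
    intro A
    by_cases hA : A.det = 0
    · exact ⟨0, 1, one_pos, fun h => absurd hA h, fun s f _ => by simp⟩
    · obtain ⟨m, hm0, hm⟩ : ∃ m : ℝ≥0, 0 < m ∧ (m : ℝ≥0∞) < ENNReal.ofReal |A.det| := by
        have : (0 : ℝ≥0∞) < ENNReal.ofReal |A.det| := by simpa using hA
        obtain ⟨m, hm0, hm⟩ := ENNReal.lt_iff_exists_nnreal_btwn.1 this
        exact ⟨m, by simpa using hm0, hm⟩
      obtain ⟨δ, hδ, hδ0⟩ := ((mul_le_addHaar_image_of_lt_det μ A hm).and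
        self_mem_nhdsWithin).exists
      exact ⟨m, δ, hδ0, fun _ => hm0.ne', hδ⟩
  choose m δ hδ hm hmδ using hr
  obtain ⟨t, A, -, -, hst, happ, hA⟩ := exists_partition_approximatesLinearOn_of_hasFDerivWithinAt
    f s f' hf' δ fun A => (hδ A).ne'
  have hst' : s ⊆ ⋃ i, s ∩ t i := by rw [← inter_iUnion]; exact subset_inter subset_rfl hst
  refine measure_mono_null hst' (measure_iUnion_null fun i => ?_)
  obtain ⟨x, hx, hAx⟩ := hA hs i
  have h1 := hmδ (A i) _ f (happ i)
  rw [measure_mono_null (image_mono inter_subset_left) h, nonpos_iff_eq_zero, mul_eq_zero] at h1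
  refine h1.resolve_left ?_
  have := hm (A i) (by rw [hAx]; exact hdet x hx)
  exact_mod_cast this

/-- The derivative of a real function vanishes at almost all points that it maps to a null set. -/
lemma ae_fderiv_eq_zero_of_mem_null {n : ℕ} (f : EuclideanSpace ℝ (Fin n) → ℝ) {N : Set ℝ}
    (hN : volume N = 0) : ∀ᵐ x, DifferentiableAt ℝ f x → f x ∈ N → fderiv ℝ f x = 0 := by
  suffices h : ∀ i : Fin n, ∀ᵐ x, DifferentiableAt ℝ f x → f x ∈ N →
      fderiv ℝ f x (EuclideanSpace.single i 1) = 0 by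
    filter_upwards [ae_all_iff.2 h] with x hx hd hxN
    refine ContinuousLinearMap.coe_injective
      ((EuclideanSpace.basisFun (Fin n) ℝ).toBasis.ext fun i => ?_)
    simpa using hx i hd hxN
  intro i
  set e : EuclideanSpace ℝ (Fin n) := EuclideanSpace.single i 1 with he
  set s := {x | DifferentiableAt ℝ f x ∧ f x ∈ N ∧ fderiv ℝ f x e ≠ 0} with hs
  suffices h : volume s = 0 by
    rw [measure_eq_zero_iff_ae_notMem] at h
    filter_upwards [h] with x hx hd hxN
    by_contra h0
    exact hx ⟨hd, hxN, h0⟩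
  -- `F` replaces the `i`-th coordinate by `f x`. Its derivative is singular only where the `i`-th
  -- partial derivative of `f` vanishes, and it sends `s` into the null set of points with `i`-th
  -- coordinate in `N`.
  let F : EuclideanSpace ℝ (Fin n) → EuclideanSpace ℝ (Fin n) := fun x => x + (f x - x i) • e
  let F' : EuclideanSpace ℝ (Fin n) → EuclideanSpace ℝ (Fin n) →L[ℝ] EuclideanSpace ℝ (Fin n) :=
    fun x => .id ℝ _ + (fderiv ℝ f x - EuclideanSpace.proj i).smulRight e
  have hFi : ∀ x, F x i = f x := fun x => by simp [F, he]
  refine addHaar_eq_zero_of_addHaar_image_eq_zero volume (f := F) (f' := F') ?_ ?_ ?_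
  · intro x hx
    refine HasFDerivAt.hasFDerivWithinAt ?_
    refine (hasFDerivAt_id x).add (HasFDerivAt.smul_const ?_ e)
    exact hx.1.hasFDerivAt.sub (EuclideanSpace.proj (𝕜 := ℝ) i).hasFDerivAt
  · intro x hx h0
    have hinj : LinearMap.ker (F' x).toLinearMap = ⊥ := by
      rw [LinearMap.ker_eq_bot']
      intro h hh
      have hh' : h + (fderiv ℝ f x h - h i) • e = 0 := by simpa [F'] using hh
      have h1 : fderiv ℝ f x h = 0 := by
        have := congrArg (fun v : EuclideanSpace ℝ (Fin n) => v i) hh'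
        simpa [he] using this
      have h2 : h = h i • e := by
        rw [h1, zero_sub, neg_smul, ← sub_eq_add_neg, sub_eq_zero] at hh'
        exact hh'
      have h3 : h i * fderiv ℝ f x e = 0 := by
        rw [← smul_eq_mul, ← map_smul, ← h2, h1]
      rw [h2, (mul_eq_zero.1 h3).resolve_right hx.2.2, zero_smul]
    have := LinearMap.bot_lt_ker_of_det_eq_zero (f := (F' x).toLinearMap) h0
    rw [hinj] at this
    exact lt_irrefl _ this
  · refine measure_mono_null (t := (fun x : EuclideanSpace ℝ (Fin n) => x i) ⁻¹' N) ?_ ?_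
    · rintro _ ⟨x, hx, rfl⟩
      change F x i ∈ N
      rw [hFi]
      exact hx.2.1
    · have h1 : Measure.QuasiMeasurePreserving (fun x : EuclideanSpace ℝ (Fin n) => x i)
          volume volume :=
        (Measure.quasiMeasurePreserving_eval (fun _ : Fin n => (volume : Measure ℝ)) i).comp
          (PiLp.volume_preserving_ofLp (Fin n)).quasiMeasurePreserving
      exact h1.preimage_null hN

end PenLSE

/-! ### `df̂` as the divergence of `μ̂` -/

namespace PenLSE

open scoped RealInnerProductSpace

section DegreesOfFreedom

variable {n p : ℕ} {X : Matrix (Fin n) (Fin p) ℝ} {ρ ρ₂ : ℝ → ℝ} {lam k c : ℝ}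

lemma mem_active {b : EuclideanSpace ℝ (Fin p)} {j : Fin p} : j ∈ active b ↔ b j ≠ 0 := by
  simp [active]

lemma projMat_mul_gram_mul (b : EuclideanSpace ℝ (Fin p)) :
    projMat b * gram X * (projMat b).transpose = subGram X (active b) := by
  ext i j
  simp [projMat, subGram, Matrix.mul_apply, Matrix.one_apply]

/-- `Q(b)` is invertible as soon as `ρ₂ ≥ -k` at the nonzero coordinates. -/
lemma isUnit_det_qMat (hc : GramGE X c) (hkc : k < c) {b : EuclideanSpace ℝ (Fin p)}
    (hb : ∀ j, b j ≠ 0 → -k ≤ ρ₂ |b j|) : IsUnit (qMat X ρ₂ b).det := by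
  rw [isUnit_iff_ne_zero]
  intro h0
  obtain ⟨w, hw0, hw⟩ := Matrix.exists_mulVec_eq_zero_iff.2 h0
  -- Extension of a null vector of `Q` by zero lets the bound for the full Gram form apply; the form
  -- of `Q` at `w` is then at least `(c - k) ‖w‖²`.
  let w' : EuclideanSpace ℝ (Fin p) :=
    WithLp.toLp 2 fun j => if h : j ∈ active b then w ⟨j, h⟩ else 0
  have hsum : ∀ f : Fin p → ℝ, ∑ j, w' j * f j = ∑ j : active b, w j * f j := by
    intro f
    rw [← Finset.sum_subset (Finset.subset_univ (active b)), ← Finset.sum_coe_sort (active b)]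
    · refine Finset.sum_congr rfl fun j _ => ?_
      simp [w']
    · intro j _ hj
      simp [w', hj]
  have hq : ∀ i : active b, (n : ℝ)⁻¹ * ⟪colVec X i, fitL X w'⟫ + ρ₂ |b i| * w i = 0 := by
    intro i
    have h1 := congrFun hw i
    rw [qMat, Matrix.add_mulVec, Pi.add_apply, Matrix.mulVec_diagonal] at h1
    simp only [Matrix.mulVec, dotProduct, subGram, Matrix.submatrix_apply, Pi.zero_apply] at h1
    rw [fitL_eq_sum, inner_sum, Finset.mul_sum, ← h1]
    congr 1
    rw [← Finset.sum_congr rfl fun j _ => mul_comm (w j) (gram X i j),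
      ← hsum fun j => gram X i j]
    refine Finset.sum_congr rfl fun j _ => ?_
    rw [real_inner_smul_right, ← inner_colVec_colVec]
    ring
  have h2 : (n : ℝ)⁻¹ * ‖fitL X w'‖ ^ 2 + ∑ j : active b, ρ₂ |b j| * w j ^ 2 = 0 := by
    have h3 : (n : ℝ)⁻¹ * ‖fitL X w'‖ ^ 2 =
        ∑ j : active b, w j * ((n : ℝ)⁻¹ * ⟪colVec X j, fitL X w'⟫) := by
      rw [← hsum fun j => (n : ℝ)⁻¹ * ⟪colVec X j, fitL X w'⟫, ← real_inner_self_eq_norm_sq]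
      nth_rewrite 1 [fitL_eq_sum]
      rw [sum_inner, Finset.mul_sum]
      refine Finset.sum_congr rfl fun j _ => ?_
      rw [real_inner_smul_left]
      ring
    rw [h3, ← Finset.sum_add_distrib]
    refine Finset.sum_eq_zero fun j _ => ?_
    have := hq j
    calc _ = w j * ((n : ℝ)⁻¹ * ⟪colVec X j, fitL X w'⟫ + ρ₂ |b j| * w j) := by ring
      _ = 0 := by rw [this, mul_zero]
  have h4 : ‖w'‖ ^ 2 = ∑ j : active b, w j ^ 2 := by
    rw [EuclideanSpace.real_norm_sq_eq]
    simp only [pow_two]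
    rw [hsum fun j => w' j]
    refine Finset.sum_congr rfl fun j _ => ?_
    simp [w']
  have h5 : -k * ‖w'‖ ^ 2 ≤ ∑ j : active b, ρ₂ |b j| * w j ^ 2 := by
    rw [h4, Finset.mul_sum]
    exact Finset.sum_le_sum fun j _ =>
      mul_le_mul_of_nonneg_right (hb j (mem_active.1 j.2)) (sq_nonneg _)
  have h6 := hc w'
  have h7 : 0 < ‖w'‖ ^ 2 := by
    rw [h4]
    obtain ⟨i, hi⟩ := Function.ne_iff.1 hw0
    exact Finset.sum_pos' (fun j _ => sq_nonneg _) ⟨i, Finset.mem_univ _, by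
      have : w i ≠ 0 := hi
      positivity⟩
  nlinarith [mul_pos (sub_pos.2 hkc) h7]

/-- If `ρ₂` vanishes at the nonzero coordinates, `df̂` counts them. -/
lemma dfHat_eq_ncard (hc : GramGE X c) (hc0 : 0 < c) {y : EuclideanSpace ℝ (Fin n)}
    (h : ∀ j, betaHat X ρ y j ≠ 0 → ρ₂ |betaHat X ρ y j| = 0) :
    dfHat X ρ ρ₂ y = (Set.ncard {j | betaHat X ρ y j ≠ 0} : ℝ) := by
  have hu := isUnit_det_qMat (ρ₂ := ρ₂) hc hc0 (b := betaHat X ρ y) fun j hj => by simp [h j hj]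
  have hQ : qMat X ρ₂ (betaHat X ρ y) = subGram X (active (betaHat X ρ y)) := by
    rw [qMat, add_eq_left]
    ext i j
    simp [Matrix.diagonal_apply, h i (mem_active.1 i.2)]
  rw [dfHat, projMat_mul_gram_mul, ← hQ, Matrix.nonsing_inv_mul _ hu, Matrix.trace_one]
  have : {j | betaHat X ρ y j ≠ 0} = (active (betaHat X ρ y) : Set (Fin p)) := by
    ext j; simp [mem_active]
  rw [this, Set.ncard_coe_finset, Fintype.card_coe]

/-- The trace defining `df̂` in terms of a matrix `D` solving the differentiated estimating
equations. -/
lemma dfHat_eq_sum {y : EuclideanSpace ℝ (Fin n)}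
    {D : EuclideanSpace ℝ (Fin n) →L[ℝ] EuclideanSpace ℝ (Fin p)}
    (hu : IsUnit (qMat X ρ₂ (betaHat X ρ y)).det)
    (h0 : ∀ j, betaHat X ρ y j = 0 → ∀ v, D v j = 0)
    (hD : ∀ j, betaHat X ρ y j ≠ 0 → ∀ v,
      (n : ℝ)⁻¹ * ⟪colVec X j, v - fitL X (D v)⟫ = ρ₂ |betaHat X ρ y j| * D v j) :
    dfHat X ρ ρ₂ y = ∑ j, D (colVec X j) j := by
  set b := betaHat X ρ y with hb
  -- Evaluating the differentiated equations along the columns gives `Q M = Σ_A`, so `df̂` is the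
  -- trace of `M`.
  let M : Matrix (active b) (active b) ℝ := fun i j => D (colVec X j) i
  have hQ : qMat X ρ₂ b * M = subGram X (active b) := by
    ext i j
    have h1 := hD i (mem_active.1 i.2) (colVec X j)
    rw [inner_sub_right, mul_sub, inner_colVec_colVec, fitL_eq_sum, inner_sum, Finset.mul_sum,
      ← Finset.sum_subset (Finset.subset_univ (active b)), ← Finset.sum_coe_sort (active b)] at h1
    · rw [qMat, Matrix.add_mul, Matrix.add_apply, Matrix.diagonal_mul, Matrix.mul_apply]
      simp only [subGram, Matrix.submatrix_apply, M]
      rw [← h1, ← add_sub_assoc, add_sub_right_comm, ← Finset.sum_sub_distrib, add_eq_right]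
      refine Finset.sum_eq_zero fun l _ => ?_
      rw [real_inner_smul_right, ← inner_colVec_colVec]
      ring
    · intro l _ hl
      rw [h0 l (by simpa [mem_active] using hl), zero_smul, inner_zero_right, mul_zero]
  rw [dfHat, projMat_mul_gram_mul, ← hb, ← hQ, Matrix.nonsing_inv_mul_cancel_left _ _ hu,
    ← Finset.sum_subset (Finset.subset_univ (active b)), ← Finset.sum_coe_sort (active b)]
  · rfl
  · intro l _ hl
    exact h0 l (by simpa [mem_active] using hl) _

/-- The differentiated estimating equations rule out nonzero coordinates at kinks of `ρ'`. -/
lemma notMem_kinks {b : EuclideanSpace ℝ (Fin p)} (hc : GramGE X c) (hc0 : 0 ≤ c) (hkc : k < c)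
    {D : EuclideanSpace ℝ (Fin n) →L[ℝ] EuclideanSpace ℝ (Fin p)}
    (hρ₂ : ∀ j, b j ≠ 0 → |b j| ∉ kinks ρ → -k ≤ ρ₂ |b j|)
    (hx : k < 0 → ∀ j, b j ≠ 0 → (n : ℝ)⁻¹ * ⟪colVec X j, colVec X j⟫ ≠ 0)
    (h0 : ∀ j, b j = 0 → ∀ v, D v j = 0)
    (hB : ∀ j, b j ≠ 0 → |b j| ∈ kinks ρ → ∀ v,
      D v j = 0 ∧ (n : ℝ)⁻¹ * ⟪colVec X j, v - fitL X (D v)⟫ = 0)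
    (hD : ∀ j, b j ≠ 0 → |b j| ∉ kinks ρ → ∀ v,
      (n : ℝ)⁻¹ * ⟪colVec X j, v - fitL X (D v)⟫ = ρ₂ |b j| * D v j)
    {j : Fin p} (hj : b j ≠ 0) : |b j| ∉ kinks ρ := by
  intro hjk
  set u := D (colVec X j) with hu
  set w := colVec X j - fitL X u with hw
  have huj : u j = 0 := (hB j hj hjk _).1
  have h1 : (n : ℝ)⁻¹ * ⟪colVec X j, w⟫ = 0 := (hB j hj hjk _).2
  have h2 : ∀ i, u i * ((n : ℝ)⁻¹ * ⟪colVec X i, w⟫) ≥ -k * u i ^ 2 := by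
    intro i
    by_cases hi : b i = 0
    · simp [hu, h0 i hi]
    by_cases hik : |b i| ∈ kinks ρ
    · simp [hu, (hB i hi hik _).1]
    · rw [hw, hu, hD i hi hik]
      nlinarith [mul_le_mul_of_nonneg_right (hρ₂ i hi hik)
        (sq_nonneg ((D (colVec X j)) i))]
  have h3 : (n : ℝ)⁻¹ * ‖w‖ ^ 2 = -∑ i, u i * ((n : ℝ)⁻¹ * ⟪colVec X i, w⟫) := by
    rw [← real_inner_self_eq_norm_sq]
    nth_rewrite 1 [hw]
    rw [inner_sub_left, mul_sub, h1, fitL_eq_sum, sum_inner, Finset.mul_sum, zero_sub]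
    congr 1
    refine Finset.sum_congr rfl fun i _ => ?_
    rw [real_inner_smul_left]
    ring
  have h4 : -k * ‖u‖ ^ 2 ≤ ∑ i, u i * ((n : ℝ)⁻¹ * ⟪colVec X i, w⟫) := by
    rw [EuclideanSpace.real_norm_sq_eq, Finset.mul_sum]
    exact Finset.sum_le_sum fun i _ => h2 i
  -- Since `u j = 0`, the vector has squared norm `1 + ‖u‖²`, so `c (1 + ‖u‖²) ≤ n⁻¹ ‖w‖² ≤ k ‖u‖²`.
  -- This is impossible for `0 ≤ k < c`; for `k < 0` it forces `u = 0`, and then `x_j` has zero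
  -- scaled norm.
  have h5 := hc (EuclideanSpace.single j 1 - u)
  rw [map_sub, fitL_single, ← hw, norm_sub_sq_real] at h5
  have h6 : ⟪(EuclideanSpace.single j (1 : ℝ) : EuclideanSpace ℝ (Fin p)), u⟫ = 0 := by
    rw [EuclideanSpace.inner_single_left, huj, mul_zero]
  rw [h6, PiLp.norm_single, norm_one] at h5
  rcases le_or_gt 0 k with hk0 | hk0
  · nlinarith [sq_nonneg ‖u‖]
  · have h7 : 0 ≤ (n : ℝ)⁻¹ * ‖w‖ ^ 2 := by positivity
    have h8 : ‖u‖ ^ 2 = 0 := by nlinarith [sq_nonneg ‖u‖]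
    have h9 : u = 0 := by simpa using h8
    rw [h9, map_zero, sub_zero] at hw
    rw [hw] at h1
    exact hx hk0 j hj h1

lemma volume_neg_eq_zero {N : Set ℝ} (h : volume N = 0) : volume (-N) = 0 := by
  rwa [Measure.measure_neg]

lemma hasDerivAt_sign_mul_comp_abs {g : ℝ → ℝ} {x g' : ℝ} (hx : x ≠ 0)
    (hg : HasDerivAt g g' |x|) :
    HasDerivAt (fun t : ℝ => (SignType.sign t : ℝ) * g |t|) g' x := by
  rcases hx.lt_or_gt with hx | hx
  · rw [abs_of_neg hx] at hg
    have h1 : HasDerivAt (fun t : ℝ => -g (-t)) g' x := by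
      have := (hg.comp x (hasDerivAt_neg x)).neg
      exact this.congr_deriv (by simp)
    refine h1.congr_of_eventuallyEq ?_
    filter_upwards [Iio_mem_nhds hx] with t ht
    rw [sign_neg ht, abs_of_neg ht]; simp
  · rw [abs_of_pos hx] at hg
    refine hg.congr_of_eventuallyEq ?_
    filter_upwards [Ioi_mem_nhds hx] with t ht
    rw [sign_pos ht, abs_of_pos ht]; simp

/-- Almost everywhere, `df̂` is the divergence of `μ̂`. -/
lemma IsPenalty.ae_dfHat_eq (hρ : IsPenalty ρ ρ₂ lam) (hlam : 0 < lam)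
    (hk : ConcavityLE ρ k) (hc : GramGE X c) (hc0 : 0 ≤ c) (hkc : k < c) :
    ∀ᵐ y : EuclideanSpace ℝ (Fin n), DifferentiableAt ℝ (betaHat X ρ) y ∧
      dfHat X ρ ρ₂ y = ∑ j, fderiv ℝ (betaHat X ρ) y (colVec X j) j := by
  obtain ⟨K, hK⟩ := hρ.exists_lipschitzWith_betaHat (X := X) hlam hk hc hkc
  set B := betaHat X ρ with hB
  let G : ℝ → ℝ := fun t => deriv ρ t + (k + 1) * t
  let W : Fin p → EuclideanSpace ℝ (Fin n) → ℝ := fun j y =>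
    (n : ℝ)⁻¹ * ⟪colVec X j, y - fitL X (B y)⟫
  -- Including zero also makes the derivatives of the zero coordinates vanish.
  have hNull1 : volume (insert 0 (kinks ρ ∪ -kinks ρ)) = 0 :=
    (measure_congr (insert_ae_eq_self _ _)).trans
      (measure_union_null hk.volume_kinks (volume_neg_eq_zero hk.volume_kinks))
  have hNull2 : volume (G '' kinks ρ ∪ -(G '' kinks ρ)) = 0 :=
    measure_union_null (hρ.volume_image_kinks hk) (volume_neg_eq_zero (hρ.volume_image_kinks hk))
  have hae1 := ae_all_iff.2 fun j : Fin p =>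
    ae_fderiv_eq_zero_of_mem_null (fun y => B y j) hNull1
  have hae2 := ae_all_iff.2 fun j : Fin p =>
    ae_fderiv_eq_zero_of_mem_null (fun y => W j y + (k + 1) * B y j) hNull2
  filter_upwards [hK.ae_differentiableAt (μ := volume), hae1, hae2] with y hd h1 h2
  refine ⟨hd, ?_⟩
  set D := fderiv ℝ B y with hDdef
  have hBj : ∀ j, HasFDerivAt (fun y => B y j) ((EuclideanSpace.proj j).comp D) y := fun j =>
    (EuclideanSpace.proj j : EuclideanSpace ℝ (Fin p) →L[ℝ] ℝ).hasFDerivAt.comp y hd.hasFDerivAt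
  have hWj : ∀ j, HasFDerivAt (W j) ((n : ℝ)⁻¹ • ((innerSL ℝ (colVec X j)).comp
      (.id ℝ _ - (fitL X).comp D))) y := by
    intro j
    refine HasFDerivAt.const_mul ?_ _
    exact (innerSL ℝ (colVec X j)).hasFDerivAt.comp y
      ((hasFDerivAt_id y).sub ((fitL X).hasFDerivAt.comp y hd.hasFDerivAt))
  have hWD : ∀ j v, ((n : ℝ)⁻¹ • ((innerSL ℝ (colVec X j)).comp
      (.id ℝ _ - (fitL X).comp D))) v = (n : ℝ)⁻¹ * ⟪colVec X j, v - fitL X (D v)⟫ := by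
    intro j v
    rw [inner_sub_right]
    simp [mul_sub]
  have hkkt : ∀ y j, B y j ≠ 0 → W j y = SignType.sign (B y j) * deriv ρ |B y j| :=
    fun y j hj => (hρ.sign_mul_deriv_eq (hρ.isMinOn_betaHat hlam hk hc hkc y) hj).symm
  have hDzero : ∀ j, B y j ∈ insert 0 (kinks ρ ∪ -kinks ρ) → ∀ v, D v j = 0 := by
    intro j hj v
    have := h1 j (hBj j).differentiableAt hj
    rw [(hBj j).fderiv] at this
    exact DFunLike.congr_fun this v
  have habs : ∀ {t : ℝ} {S : Set ℝ}, |t| ∈ S → t ∈ S ∪ -S := by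
    intro t S ht
    rcases abs_choice t with h | h <;> rw [h] at ht
    exacts [Or.inl ht, Or.inr ht]
  have hH0 : ∀ j, B y j = 0 → ∀ v, D v j = 0 := fun j hj =>
    hDzero j (by rw [hj]; exact mem_insert _ _)
  have hHB : ∀ j, B y j ≠ 0 → |B y j| ∈ kinks ρ → ∀ v,
      D v j = 0 ∧ (n : ℝ)⁻¹ * ⟪colVec X j, v - fitL X (D v)⟫ = 0 := by
    intro j hj hjk v
    have hz := hDzero j (mem_insert_of_mem _ (habs hjk))
    refine ⟨hz v, ?_⟩
    have hsum : HasFDerivAt (fun y => W j y + (k + 1) * B y j) _ y :=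
      (hWj j).add ((hBj j).const_mul (k + 1))
    have hmem : W j y + (k + 1) * B y j ∈ G '' kinks ρ ∪ -(G '' kinks ρ) := by
      -- The estimating equation turns score plus `(k + 1) β̂_j` into a signed value of `G`, so at a
      -- kink it lies in a null set.
      have hG : W j y + (k + 1) * B y j = SignType.sign (B y j) * G |B y j| := by
        rw [hkkt y j hj]
        nth_rewrite 3 [← sign_mul_abs (B y j)]
        simp only [G]
        ring
      rw [hG]
      rcases hj.lt_or_gt with h | h
      · right
        rw [sign_neg h]
        simpa using ⟨_, hjk, rfl⟩
      · left
        rw [sign_pos h]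
        simpa using ⟨_, hjk, rfl⟩
    have := h2 j hsum.differentiableAt hmem
    rw [hsum.fderiv] at this
    have h3 := DFunLike.congr_fun this v
    rw [_root_.add_apply, hWD] at h3
    simpa [hz v] using h3
  have hHD : ∀ j, B y j ≠ 0 → |B y j| ∉ kinks ρ → ∀ v,
      (n : ℝ)⁻¹ * ⟪colVec X j, v - fitL X (D v)⟫ = ρ₂ |B y j| * D v j := by
    intro j hj hjk v
    have hdρ : DifferentiableAt ℝ (deriv ρ) |B y j| := by
      by_contra h
      exact hjk ⟨abs_pos.2 hj, h⟩
    have h3 := hasDerivAt_sign_mul_comp_abs hj hdρ.hasDerivAt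
    rw [← hρ.second_deriv _ (abs_pos.2 hj) hdρ] at h3
    have h4 := h3.comp_hasFDerivAt (f := fun y => B y j) y (hBj j)
    have h5 : W j =ᶠ[𝓝 y] (fun t : ℝ => (SignType.sign t : ℝ) * deriv ρ |t|) ∘ fun y => B y j := by
      filter_upwards [(hBj j).continuousAt.eventually_ne hj] with z hz
      exact hkkt z j hz
    have h6 := (h4.congr_of_eventuallyEq h5).unique (hWj j)
    rw [← hWD, ← h6]
    simp
  have hρ₂ : ∀ j, B y j ≠ 0 → |B y j| ∉ kinks ρ → -k ≤ ρ₂ |B y j| := by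
    intro j hj hjk
    refine hρ.le_second_deriv hk (abs_pos.2 hj) ?_
    by_contra h
    exact hjk ⟨abs_pos.2 hj, h⟩
  -- A zero column would give score zero, hence `ρ'(|β̂_j|) = 0`, whereas for `k < 0` the slope
  -- exceeds `lam`.
  have hx : k < 0 → ∀ j, B y j ≠ 0 → (n : ℝ)⁻¹ * ⟪colVec X j, colVec X j⟫ ≠ 0 := by
    intro hk0 j hj h0
    have hz : W j y = 0 := by
      rcases mul_eq_zero.1 h0 with h | h
      · simp only [W, h, zero_mul]
      · simp only [W, inner_self_eq_zero.1 h, inner_zero_left, mul_zero]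
    rw [hkkt y j hj] at hz
    have h3 := hρ.le_deriv_add hk (abs_pos.2 hj)
    have h4 : k * |B y j| < 0 := mul_neg_of_neg_of_pos hk0 (abs_pos.2 hj)
    rcases mul_eq_zero.1 hz with h | h
    · rcases hj.lt_or_gt with h' | h'
      · rw [sign_neg h'] at h; norm_num at h
      · rw [sign_pos h'] at h; norm_num at h
    · linarith
  have hnk : ∀ j, B y j ≠ 0 → |B y j| ∉ kinks ρ := fun j hj =>
    notMem_kinks hc hc0 hkc hρ₂ hx hH0 hHB hHD hj
  exact dfHat_eq_sum (isUnit_det_qMat hc hkc fun j hj => hρ₂ j hj (hnk j hj)) hH0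
    fun j hj => hHD j hj (hnk j hj)

end DegreesOfFreedom

end PenLSE

/-! ### Integration by parts for Lipschitz functions -/

namespace PenLSE

open scoped RealInnerProductSpace ENNReal NNReal

section Stein

lemma _root_.LipschitzWith.norm_le_mul_one_add {E : Type*} [NormedAddCommGroup E]
    {f : E → ℝ} {C : ℝ≥0} (hf : LipschitzWith C f) (x : E) : ‖f x‖ ≤ (‖f 0‖ + C) * (1 + ‖x‖) := by
  have h1 : ‖f x - f 0‖ ≤ C * ‖x‖ := by simpa using hf.norm_sub_le x 0
  have h2 : ‖f x‖ ≤ ‖f 0‖ + ‖f x - f 0‖ := by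
    simpa using norm_add_le (f 0) (f x - f 0)
  have h3 : 0 ≤ ‖f 0‖ * ‖x‖ := by positivity
  have h4 : (0 : ℝ) ≤ C := C.2
  nlinarith

section

variable {E : Type*} [NormedAddCommGroup E] [InnerProductSpace ℝ E]

lemma hasDerivAt_exp_neg_mul_norm_sq (a : ℝ) (x v : E) (t : ℝ) :
    HasDerivAt (fun t : ℝ => Real.exp (-a * ‖x - t • v‖ ^ 2))
      (2 * a * ⟪x - t • v, v⟫ * Real.exp (-a * ‖x - t • v‖ ^ 2)) t := by
  have h := (((hasDerivAt_id t).smul_const v).const_sub x).norm_sq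
  refine (h.const_mul (-a)).exp.congr_deriv ?_
  simp
  ring

/-- Domination uniform in the shift: `‖x‖² ≤ 2 ‖x - t v‖² + 2 ‖v‖²` costs half of the exponent. -/
lemma exp_neg_mul_norm_sub_sq_le {a : ℝ} (ha : 0 < a) (x v : E) {t : ℝ} (ht0 : 0 ≤ t)
    (ht1 : t ≤ 1) :
    Real.exp (-a * ‖x - t • v‖ ^ 2) ≤
      Real.exp (a * ‖v‖ ^ 2) * Real.exp (-(a / 2) * ‖x‖ ^ 2) := by
  rw [← Real.exp_add, Real.exp_le_exp]
  have h1 : ‖x‖ ≤ ‖x - t • v‖ + ‖v‖ := by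
    have h2 : ‖t • v‖ ≤ ‖v‖ := by
      rw [norm_smul, Real.norm_of_nonneg ht0]
      exact mul_le_of_le_one_left (norm_nonneg _) ht1
    calc ‖x‖ = ‖(x - t • v) + t • v‖ := by rw [sub_add_cancel]
      _ ≤ _ := (norm_add_le _ _).trans (by linarith)
  have h3 : ‖x‖ ^ 2 ≤ 2 * ‖x - t • v‖ ^ 2 + 2 * ‖v‖ ^ 2 := by
    have := pow_le_pow_left₀ (norm_nonneg x) h1 2
    nlinarith [sq_nonneg (‖x - t • v‖ - ‖v‖)]
  nlinarith

lemma abs_exp_neg_mul_norm_sub_sq_sub_le {a : ℝ} (ha : 0 < a) (x v : E) {t : ℝ} (ht0 : 0 ≤ t)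
    (ht1 : t ≤ 1) :
    |Real.exp (-a * ‖x - t • v‖ ^ 2) - Real.exp (-a * ‖x‖ ^ 2)| ≤
      2 * a * (‖x‖ + ‖v‖) * ‖v‖ *
        (Real.exp (a * ‖v‖ ^ 2) * Real.exp (-(a / 2) * ‖x‖ ^ 2)) * t := by
  have h := Convex.norm_image_sub_le_of_norm_hasDerivWithin_le (s := Icc (0 : ℝ) 1)
    (f := fun t : ℝ => Real.exp (-a * ‖x - t • v‖ ^ 2)) (x := 0) (y := t)
    (C := 2 * a * (‖x‖ + ‖v‖) * ‖v‖ * (Real.exp (a * ‖v‖ ^ 2) * Real.exp (-(a / 2) * ‖x‖ ^ 2)))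
    (fun s _ => (hasDerivAt_exp_neg_mul_norm_sq a x v s).hasDerivWithinAt) ?_
    (convex_Icc 0 1) (by simp) ⟨ht0, ht1⟩
  · simpa [abs_of_nonneg ht0] using h
  · intro s hs
    rw [norm_mul, Real.norm_of_nonneg (Real.exp_pos _).le, norm_mul,
      Real.norm_of_nonneg (by positivity : (0 : ℝ) ≤ 2 * a)]
    have h1 : ‖⟪x - s • v, v⟫‖ ≤ (‖x‖ + ‖v‖) * ‖v‖ := by
      refine (norm_inner_le_norm _ _).trans (mul_le_mul_of_nonneg_right ?_ (norm_nonneg _))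
      refine (norm_sub_le _ _).trans (add_le_add_right ?_ _)
      rw [norm_smul, Real.norm_of_nonneg hs.1]
      exact mul_le_of_le_one_left (norm_nonneg _) hs.2
    rw [mul_assoc (2 * a) (‖x‖ + ‖v‖)]
    exact mul_le_mul (mul_le_mul_of_nonneg_left h1 (by positivity))
      (exp_neg_mul_norm_sub_sq_le ha x v hs.1 hs.2) (Real.exp_pos _).le (by positivity)

end

variable {E : Type*} [NormedAddCommGroup E] [InnerProductSpace ℝ E] [FiniteDimensional ℝ E]
  [MeasurableSpace E] [BorelSpace E]

lemma integrable_exp_neg_mul_norm_sq {a : ℝ} (ha : 0 < a) :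
    Integrable fun x : E => Real.exp (-a * ‖x‖ ^ 2) := by
  have h := (GaussianFourier.integrable_cexp_neg_mul_sq_norm_add (V := E) (b := (a : ℂ))
    (by simpa using ha) 0 0).norm
  refine h.congr (Eventually.of_forall fun x => ?_)
  simp only [zero_mul, add_zero, Complex.norm_exp]
  norm_cast

lemma integrable_one_add_sq_mul_exp {a : ℝ} (ha : 0 < a) :
    Integrable fun x : E => (1 + ‖x‖) ^ 2 * Real.exp (-a * ‖x‖ ^ 2) := by
  refine ((integrable_exp_neg_mul_norm_sq (E := E) (half_pos ha)).const_mul (2 + 4 / a)).mono'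
    (by fun_prop) (Eventually.of_forall fun x => ?_)
  rw [Real.norm_of_nonneg (by positivity)]
  have h1 : Real.exp (-a * ‖x‖ ^ 2) =
      Real.exp (-(a / 2) * ‖x‖ ^ 2) * Real.exp (-(a / 2) * ‖x‖ ^ 2) := by
    rw [← Real.exp_add]; ring_nf
  have h2 : (1 + ‖x‖) ^ 2 ≤ (2 + 4 / a) * Real.exp (a / 2 * ‖x‖ ^ 2) := by
    have h3 := Real.add_one_le_exp (a / 2 * ‖x‖ ^ 2)
    have h4 : (1 + ‖x‖) ^ 2 ≤ 2 + 2 * ‖x‖ ^ 2 := by nlinarith [sq_nonneg (1 - ‖x‖)]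
    have h5 : 2 + 2 * ‖x‖ ^ 2 ≤ (2 + 4 / a) * (a / 2 * ‖x‖ ^ 2 + 1) := by
      have : (2 + 4 / a) * (a / 2 * ‖x‖ ^ 2 + 1) =
          2 + 2 * ‖x‖ ^ 2 + (a * ‖x‖ ^ 2 + 4 / a) := by field_simp; ring
      rw [this]
      have : 0 ≤ a * ‖x‖ ^ 2 + 4 / a := by positivity
      linarith
    exact h4.trans (h5.trans (mul_le_mul_of_nonneg_left h3 (by positivity)))
  have h6 : Real.exp (a / 2 * ‖x‖ ^ 2) * Real.exp (-(a / 2) * ‖x‖ ^ 2) = 1 := by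
    rw [← Real.exp_add, neg_mul, add_neg_cancel, Real.exp_zero]
  rw [h1, ← mul_assoc]
  refine mul_le_mul_of_nonneg_right ?_ (Real.exp_pos _).le
  calc (1 + ‖x‖) ^ 2 * Real.exp (-(a / 2) * ‖x‖ ^ 2)
      ≤ (2 + 4 / a) * Real.exp (a / 2 * ‖x‖ ^ 2) * Real.exp (-(a / 2) * ‖x‖ ^ 2) :=
        mul_le_mul_of_nonneg_right h2 (Real.exp_pos _).le
    _ = 2 + 4 / a := by rw [mul_assoc, h6, mul_one]

/-- Integration by parts for a Lipschitz function against a Gaussian weight. -/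
lemma integral_lineDeriv_mul_exp {f : E → ℝ} {C : ℝ≥0} (hf : LipschitzWith C f) {a : ℝ}
    (ha : 0 < a) (v : E) :
    ∫ x, lineDeriv ℝ f x v * Real.exp (-a * ‖x‖ ^ 2) =
      ∫ x, 2 * a * (⟪x, v⟫ * f x) * Real.exp (-a * ‖x‖ ^ 2) := by
  set g : E → ℝ := fun x => Real.exp (-a * ‖x‖ ^ 2) with hg
  have hcf : Continuous f := hf.continuous
  have hcg : Continuous g := by fun_prop
  set A := ‖f 0‖ + C with hA
  have hA0 : 0 ≤ A := by positivity
  have hint : ∀ w : E, Integrable fun x => f (x + w) * g x := by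
    intro w
    refine ((integrable_one_add_sq_mul_exp (E := E) ha).const_mul (A * (1 + ‖w‖))).mono'
      (by fun_prop) (Eventually.of_forall fun x => ?_)
    rw [norm_mul, Real.norm_of_nonneg (Real.exp_pos _).le, ← mul_assoc]
    refine mul_le_mul_of_nonneg_right ?_ (Real.exp_pos _).le
    refine (hf.norm_le_mul_one_add _).trans ?_
    rw [mul_assoc]
    refine mul_le_mul_of_nonneg_left ?_ hA0
    have := norm_add_le x w
    nlinarith [norm_nonneg x, norm_nonneg w, mul_nonneg (norm_nonneg x) (norm_nonneg w),
      mul_nonneg (norm_nonneg w) (sq_nonneg ‖x‖)]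
  -- Translation invariance moves the difference quotient from `f` to the smooth weight; both forms
  -- then have a limit as `t` decreases to zero.
  have hswap : ∀ t : ℝ, ∫ x, (t⁻¹ • (f (x + t • v) - f x)) * g x =
      ∫ x, t⁻¹ * (f x * (g (x - t • v) - g x)) := by
    intro t
    have h0 : Integrable fun x => f x * g x := by simpa using hint 0
    have h1 : Integrable fun x => f x * g (x - t • v) := by
      have := (hint (t • v)).comp_sub_right (t • v)
      simpa using this
    have h2 : ∫ x, f (x + t • v) * g x = ∫ x, f x * g (x - t • v) := by
      have := integral_sub_right_eq_self (μ := volume) (fun x => f (x + t • v) * g x) (t • v)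
      simpa using this.symm
    calc ∫ x, (t⁻¹ • (f (x + t • v) - f x)) * g x
        = ∫ x, t⁻¹ * (f (x + t • v) * g x - f x * g x) := by
          congr 1; ext x; simp only [smul_eq_mul]; ring
      _ = t⁻¹ * ((∫ x, f x * g (x - t • v)) - ∫ x, f x * g x) := by
          rw [integral_const_mul, integral_sub (hint _) h0, h2]
      _ = _ := by
          rw [← integral_sub h1 h0, ← integral_const_mul]
          congr 1; ext x; ring
  have hlim1 := hf.integral_inv_smul_sub_mul_tendsto_integral_lineDeriv_mul (μ := volume)
    (integrable_exp_neg_mul_norm_sq (E := E) ha) v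
  have hlim2 : Tendsto (fun t : ℝ => ∫ x, (t⁻¹ • (f (x + t • v) - f x)) * g x) (𝓝[>] 0)
      (𝓝 (∫ x, 2 * a * (⟪x, v⟫ * f x) * g x)) := by
    simp only [hswap]
    set M := A * (2 * a * (1 + ‖v‖) * ‖v‖ * Real.exp (a * ‖v‖ ^ 2)) with hM
    refine tendsto_integral_filter_of_dominated_convergence
      (fun x => M * ((1 + ‖x‖) ^ 2 * Real.exp (-(a / 2) * ‖x‖ ^ 2))) ?_ ?_ ?_ ?_
    · exact Eventually.of_forall fun t => by fun_prop
    · filter_upwards [Ioo_mem_nhdsGT (one_pos : (0 : ℝ) < 1)] with t ht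
      refine Eventually.of_forall fun x => ?_
      have h1 := abs_exp_neg_mul_norm_sub_sq_sub_le ha x v ht.1.le ht.2.le
      have h2 := hf.norm_le_mul_one_add x
      rw [norm_mul, norm_mul, norm_inv, Real.norm_of_nonneg ht.1.le, inv_mul_le_iff₀ ht.1]
      have h3 : ‖x‖ + ‖v‖ ≤ (1 + ‖v‖) * (1 + ‖x‖) := by
        nlinarith [mul_nonneg (norm_nonneg x) (norm_nonneg v)]
      calc ‖f x‖ * ‖g (x - t • v) - g x‖
          ≤ (A * (1 + ‖x‖)) * (2 * a * (‖x‖ + ‖v‖) * ‖v‖ *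
            (Real.exp (a * ‖v‖ ^ 2) * Real.exp (-(a / 2) * ‖x‖ ^ 2)) * t) :=
            mul_le_mul h2 h1 (norm_nonneg _) (by positivity)
        _ ≤ (A * (1 + ‖x‖)) * (2 * a * ((1 + ‖v‖) * (1 + ‖x‖)) * ‖v‖ *
            (Real.exp (a * ‖v‖ ^ 2) * Real.exp (-(a / 2) * ‖x‖ ^ 2)) * t) := by
            have := ht.1
            gcongr
        _ = _ := by rw [hM]; ring
    · exact (integrable_one_add_sq_mul_exp (half_pos ha)).const_mul M
    · refine Eventually.of_forall fun x => ?_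
      have h1 := (hasDerivAt_exp_neg_mul_norm_sq a x v 0).tendsto_slope_zero_right
      have h2 := h1.const_mul (f x)
      simp only [zero_add, zero_smul, sub_zero, smul_eq_mul] at h2
      refine (h2.congr fun t => ?_).trans_eq ?_
      · simp only [hg]; ring
      · simp only [hg]; ring_nf
  exact tendsto_nhds_unique hlim1 hlim2

end Stein

/-! ### The isotropic Gaussian density and Stein's identity -/

section Gaussian

variable {n : ℕ} {σ : ℝ}

/-- The law `N(0, σ² I_n)`. -/
noncomputable abbrev isoGaussian (n : ℕ) (σ : ℝ) : Measure (EuclideanSpace ℝ (Fin n)) :=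
  multivariateGaussian 0 (σ ^ 2 • (1 : Matrix (Fin n) (Fin n) ℝ))

lemma posSemidef_sq_smul_one (σ : ℝ) :
    (σ ^ 2 • (1 : Matrix (Fin n) (Fin n) ℝ)).PosSemidef :=
  Matrix.PosSemidef.one.smul (sq_nonneg σ)

/-- The two measures are matched through their characteristic functions. -/
lemma exists_isoGaussian_eq_withDensity (hσ : 0 < σ) :
    ∃ C : ℝ, 0 ≤ C ∧ isoGaussian n σ = volume.withDensity fun x =>
      ENNReal.ofReal (C * Real.exp (-(2 * σ ^ 2)⁻¹ * ‖x‖ ^ 2)) := by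
  set a := (2 * σ ^ 2)⁻¹ with ha
  have ha0 : 0 < a := by positivity
  set Z := ∫ x : EuclideanSpace ℝ (Fin n), Real.exp (-a * ‖x‖ ^ 2) with hZ
  have hZ' : Z = (Real.pi / a) ^ (Module.finrank ℝ (EuclideanSpace ℝ (Fin n)) / 2 : ℝ) :=
    GaussianFourier.integral_rexp_neg_mul_sq_norm ha0
  have hZ0 : 0 < Z := by rw [hZ']; positivity
  have hZc : (Z : ℂ) = (Real.pi / a : ℂ) ^
      (Module.finrank ℝ (EuclideanSpace ℝ (Fin n)) / 2 : ℂ) := by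
    rw [hZ', Complex.ofReal_cpow (by positivity)]
    push_cast
    rfl
  refine ⟨Z⁻¹, by positivity, ?_⟩
  have hint : Integrable fun x : EuclideanSpace ℝ (Fin n) => Z⁻¹ * Real.exp (-a * ‖x‖ ^ 2) :=
    (integrable_exp_neg_mul_norm_sq ha0).const_mul _
  have : IsFiniteMeasure ((volume : Measure (EuclideanSpace ℝ (Fin n))).withDensity fun x =>
      ENNReal.ofReal (Z⁻¹ * Real.exp (-a * ‖x‖ ^ 2))) :=
    isFiniteMeasure_withDensity_ofReal hint.2
  refine Measure.ext_of_charFun ?_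
  ext t
  rw [charFun_multivariateGaussian (posSemidef_sq_smul_one σ), charFun_apply,
    integral_withDensity_eq_integral_toReal_smul (by fun_prop)
      (Eventually.of_forall fun _ => ENNReal.ofReal_lt_top)]
  have h1 : ∀ x : EuclideanSpace ℝ (Fin n),
      (ENNReal.ofReal (Z⁻¹ * Real.exp (-a * ‖x‖ ^ 2))).toReal • Complex.exp (⟪x, t⟫ * Complex.I) =
        (Z : ℂ)⁻¹ * Complex.exp (-(a : ℂ) * ‖x‖ ^ 2 + Complex.I * ⟪t, x⟫) := by
    intro x
    rw [ENNReal.toReal_ofReal (by positivity), Complex.real_smul, Complex.exp_add,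
      real_inner_comm]
    push_cast
    ring_nf
  simp only [h1]
  rw [integral_const_mul, GaussianFourier.integral_cexp_neg_mul_sq_norm_add (by simpa using ha0),
    ← hZc, ← mul_assoc, inv_mul_cancel₀ (by exact_mod_cast hZ0.ne'), one_mul]
  congr 1
  have h2 : (t.ofLp ⬝ᵥ (σ ^ 2 • (1 : Matrix (Fin n) (Fin n) ℝ)).mulVec t.ofLp) =
      σ ^ 2 * ‖t‖ ^ 2 := by
    rw [Matrix.smul_mulVec, Matrix.one_mulVec, dotProduct_smul, smul_eq_mul,
      EuclideanSpace.real_norm_sq_eq]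
    simp [dotProduct, pow_two]
  rw [h2, inner_zero_right, ha]
  push_cast
  rw [Complex.I_sq]
  have : (σ : ℂ) ≠ 0 := by exact_mod_cast hσ.ne'
  field_simp
  ring

lemma isoGaussian_absolutelyContinuous (hσ : 0 < σ) : isoGaussian n σ ≪ volume := by
  obtain ⟨C, -, h⟩ := exists_isoGaussian_eq_withDensity (n := n) hσ
  rw [h]
  exact withDensity_absolutelyContinuous _ _

/-- Stein's identity for Lipschitz functions. -/
lemma integral_inner_mul_isoGaussian (hσ : 0 < σ) {f : EuclideanSpace ℝ (Fin n) → ℝ} {C : ℝ≥0}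
    (hf : LipschitzWith C f) (v : EuclideanSpace ℝ (Fin n)) :
    ∫ x, ⟪x, v⟫ * f x ∂(isoGaussian n σ) =
      σ ^ 2 * ∫ x, lineDeriv ℝ f x v ∂(isoGaussian n σ) := by
  obtain ⟨Z, hZ, h⟩ := exists_isoGaussian_eq_withDensity (n := n) hσ
  have h1 : ∀ F : EuclideanSpace ℝ (Fin n) → ℝ, ∫ x, F x ∂(isoGaussian n σ) =
      Z * ∫ x, F x * Real.exp (-(2 * σ ^ 2)⁻¹ * ‖x‖ ^ 2) := by
    intro F
    rw [h, integral_withDensity_eq_integral_toReal_smul (by fun_prop)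
      (Eventually.of_forall fun _ => ENNReal.ofReal_lt_top), ← integral_const_mul]
    congr 1
    ext x
    rw [ENNReal.toReal_ofReal (by positivity), smul_eq_mul]
    ring
  rw [h1, h1, integral_lineDeriv_mul_exp hf (by positivity) v, ← integral_const_mul,
    ← integral_const_mul, ← integral_const_mul]
  congr 1
  ext x
  field_simp

end Gaussian

end PenLSE

namespace PenLSE

open scoped RealInnerProductSpace ENNReal NNReal

/-! ### Moments and projections of Gaussian noise -/

section GaussianMoments

variable {n : ℕ} {σ : ℝ}

lemma memLp_two_isoGaussian {F : Type*} [NormedAddCommGroup F] [SecondCountableTopology F]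
    [MeasurableSpace F] [BorelSpace F]
    {f : EuclideanSpace ℝ (Fin n) → F} {C : ℝ≥0} (hf : LipschitzWith C f) :
    MemLp f 2 (isoGaussian n σ) := by
  have h0 : MemLp (fun x : EuclideanSpace ℝ (Fin n) => x) 2 (isoGaussian n σ) :=
    IsGaussian.memLp_two_id
  have h1 : MemLp (fun x : EuclideanSpace ℝ (Fin n) => ‖f 0‖ + C * ‖x‖) 2 (isoGaussian n σ) := by
    have h2 := h0.norm.const_mul (C : ℝ)
    have h3 : MemLp (fun _ : EuclideanSpace ℝ (Fin n) => ‖f 0‖) 2 (isoGaussian n σ) :=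
      memLp_const _
    exact h3.add h2
  refine h1.mono hf.continuous.aestronglyMeasurable (Eventually.of_forall fun x => ?_)
  rw [Real.norm_of_nonneg (by positivity)]
  have h2 : ‖f x - f 0‖ ≤ C * ‖x‖ := by simpa using hf.norm_sub_le x 0
  calc ‖f x‖ = ‖f 0 + (f x - f 0)‖ := by rw [add_sub_cancel]
    _ ≤ _ := (norm_add_le _ _).trans (by linarith)

lemma inner_left_eq_innerSL (v : EuclideanSpace ℝ (Fin n)) :
    (fun x : EuclideanSpace ℝ (Fin n) => ⟪x, v⟫) = innerSL ℝ v := by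
  ext x
  exact real_inner_comm _ _

lemma lipschitzWith_inner_left (v : EuclideanSpace ℝ (Fin n)) :
    LipschitzWith ‖innerSL ℝ v‖₊ fun x : EuclideanSpace ℝ (Fin n) => ⟪x, v⟫ := by
  rw [inner_left_eq_innerSL]
  exact (innerSL ℝ v).lipschitz

lemma integral_inner_isoGaussian (hσ : 0 < σ) (v : EuclideanSpace ℝ (Fin n)) :
    ∫ x, ⟪x, v⟫ ∂(isoGaussian n σ) = 0 := by
  have h := integral_inner_mul_isoGaussian hσ
    (LipschitzWith.const (α := EuclideanSpace ℝ (Fin n)) (1 : ℝ)) v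
  simpa [lineDeriv] using h

lemma integral_inner_mul_inner_isoGaussian (hσ : 0 < σ) (u v : EuclideanSpace ℝ (Fin n)) :
    ∫ x, ⟪x, u⟫ * ⟪x, v⟫ ∂(isoGaussian n σ) = σ ^ 2 * ⟪u, v⟫ := by
  rw [integral_inner_mul_isoGaussian hσ (lipschitzWith_inner_left v) u]
  have h : ∀ x : EuclideanSpace ℝ (Fin n),
      lineDeriv ℝ (fun x : EuclideanSpace ℝ (Fin n) => ⟪x, v⟫) x u = ⟪u, v⟫ := by
    intro x
    have h1 : HasFDerivAt (fun x : EuclideanSpace ℝ (Fin n) => ⟪x, v⟫) (innerSL ℝ v) x := by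
      rw [inner_left_eq_innerSL]
      exact (innerSL ℝ v).hasFDerivAt
    rw [h1.differentiableAt.lineDeriv_eq_fderiv, h1.fderiv, innerSL_apply_apply, real_inner_comm]
  simp [h]

lemma integral_norm_sq_starProjection (hσ : 0 < σ)
    (U : Submodule ℝ (EuclideanSpace ℝ (Fin n))) :
    ∫ x, ‖U.starProjection x‖ ^ 2 ∂(isoGaussian n σ) = σ ^ 2 * Module.finrank ℝ U := by
  set b := stdOrthonormalBasis ℝ U
  have h1 : ∀ x, ‖U.starProjection x‖ ^ 2 =
      ∑ i, ⟪x, (b i : EuclideanSpace ℝ (Fin n))⟫ * ⟪x, (b i : EuclideanSpace ℝ (Fin n))⟫ := by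
    intro x
    rw [Submodule.starProjection_apply, ← Submodule.coe_norm, ← b.sum_sq_inner_right]
    refine Finset.sum_congr rfl fun i _ => ?_
    rw [← pow_two, Submodule.coe_inner, ← Submodule.starProjection_apply,
      ← Submodule.inner_starProjection_left_eq_right,
      Submodule.starProjection_eq_self_iff.2 (b i).2, real_inner_comm]
  simp only [h1]
  rw [integral_finsetSum]
  · simp only [integral_inner_mul_inner_isoGaussian hσ]
    have h2 : ∀ i, ⟪(b i : EuclideanSpace ℝ (Fin n)), (b i : EuclideanSpace ℝ (Fin n))⟫ = 1 := by
      intro i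
      rw [← Submodule.coe_inner, real_inner_self_eq_norm_sq, b.norm_eq_one, one_pow]
    simp only [h2, mul_one, Finset.sum_const, Finset.card_univ, Fintype.card_fin, nsmul_eq_mul]
    ring
  · intro i _
    exact (memLp_two_isoGaussian (lipschitzWith_inner_left _)).integrable_mul
      (memLp_two_isoGaussian (lipschitzWith_inner_left _))

/-- The two projections are jointly Gaussian, and their covariances are multiples of inner products
between `U` and its complement. -/
lemma indepFun_starProjection (σ : ℝ) (U : Submodule ℝ (EuclideanSpace ℝ (Fin n))) :
    IndepFun (fun x => U.starProjection x) (fun x => Uᗮ.starProjection x) (isoGaussian n σ) := by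
  refine HasGaussianLaw.indepFun_of_covariance_inner ?_ fun x y => ?_
  · exact (IsGaussian.hasGaussianLaw_id (μ := isoGaussian n σ)).map_fun
      (U.starProjection.prod Uᗮ.starProjection)
  · simp only [← Submodule.inner_starProjection_left_eq_right]
    rw [← covarianceBilin_apply_eq_cov IsGaussian.memLp_two_id,
      covarianceBilin_multivariateGaussian (posSemidef_sq_smul_one σ), Matrix.smul_mulVec,
      Matrix.one_mulVec, dotProduct_smul]
    have h := U.inner_right_of_mem_orthogonal (U.starProjection_apply_mem x)
      (Uᗮ.starProjection_apply_mem y)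
    rw [PiLp.inner_apply] at h
    rw [show (U.starProjection x).ofLp ⬝ᵥ (Uᗮ.starProjection y).ofLp = 0 from ?_, smul_zero]
    rw [← h]
    simp [dotProduct, mul_comm]

end GaussianMoments

/-! ### Column span, least squares and the divergence -/

section ColumnSpace

variable {n p : ℕ} {X : Matrix (Fin n) (Fin p) ℝ} {ρ ρ₂ : ℝ → ℝ} {lam k c : ℝ}

/-- The linear span of the columns of `X`. -/
noncomputable def colSpan (X : Matrix (Fin n) (Fin p) ℝ) :
    Submodule ℝ (EuclideanSpace ℝ (Fin n)) :=
  Submodule.span ℝ (range (colVec X))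

lemma muTilde_eq (y : EuclideanSpace ℝ (Fin n)) : muTilde X y = (colSpan X).starProjection y :=
  rfl

lemma colVec_mem_colSpan (j : Fin p) : colVec X j ∈ colSpan X :=
  Submodule.subset_span (mem_range_self j)

lemma fitL_mem_colSpan (b : EuclideanSpace ℝ (Fin p)) : fitL X b ∈ colSpan X := by
  rw [fitL_eq_sum]
  exact Submodule.sum_mem _ fun j _ => Submodule.smul_mem _ _ (colVec_mem_colSpan j)

lemma finrank_colSpan : Module.finrank ℝ (colSpan X) = X.rank := by
  rw [Matrix.rank_eq_finrank_span_cols,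
    ← LinearEquiv.finrank_map_eq (WithLp.linearEquiv 2 ℝ (Fin n → ℝ)).symm, Submodule.map_span,
    ← range_comp]
  rfl

lemma rank_eq_of_isUnit_gram (h : IsUnit (gram X)) : X.rank = p := by
  refine le_antisymm (by simpa using X.rank_le_width) ?_
  have h1 := Matrix.rank_of_isUnit _ h
  rw [Fintype.card_fin] at h1
  rw [← Matrix.rank_transpose_mul_self X]
  conv_lhs => rw [← h1]
  rw [gram, ← Matrix.one_mul (X.transpose * X), ← Matrix.smul_mul]
  simp only [Matrix.one_mul]
  exact Matrix.rank_mul_le_right _ _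

lemma inner_colVec (j : Fin p) (v : EuclideanSpace ℝ (Fin n)) :
    ⟪colVec X j, v⟫ = X.transpose.toEuclideanLin v j := by
  simp [colVec, Matrix.toLpLin_apply, PiLp.inner_apply, Matrix.mulVec, dotProduct, mul_comm]

/-- The normal equations say that the residual is orthogonal to every column. -/
lemma fitL_betaTilde (hn : 0 < n) (h : IsUnit (gram X)) (y : EuclideanSpace ℝ (Fin n)) :
    fitL X (betaTilde X y) = (colSpan X).starProjection y := by
  have hn' : (n : ℝ) ≠ 0 := by exact_mod_cast hn.ne'
  have hdet : IsUnit (gram X).det := (Matrix.isUnit_iff_isUnit_det _).1 h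
  have hgram : ∀ b : EuclideanSpace ℝ (Fin p), ∀ j,
      (gram X).toEuclideanLin b j = (n : ℝ)⁻¹ * ⟪colVec X j, fitL X b⟫ := by
    intro b j
    have := inner_gram X b (EuclideanSpace.single j 1)
    rw [fitL_single, real_inner_comm, EuclideanSpace.inner_single_left, real_inner_comm] at this
    simpa using this
  symm
  refine Submodule.eq_starProjection_of_mem_orthogonal (fitL_mem_colSpan _) ?_
  rw [colSpan, Submodule.mem_orthogonal]
  intro u hu
  induction hu using Submodule.span_induction with
  | mem x hx =>
    obtain ⟨j, rfl⟩ := hx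
    have h1 := hgram (betaTilde X y) j
    have h2 : (gram X).toEuclideanLin (betaTilde X y) =
        (n : ℝ)⁻¹ • X.transpose.toEuclideanLin y := by
      simp only [betaTilde, Matrix.toLpLin_apply, Matrix.mulVec_mulVec,
        Matrix.mul_nonsing_inv _ hdet, Matrix.one_mulVec]
    rw [h2, PiLp.smul_apply, smul_eq_mul, ← inner_colVec] at h1
    rw [inner_sub_right, mul_left_cancel₀ (inv_ne_zero hn') h1, sub_self]
  | zero => exact inner_zero_left _
  | add x y _ _ hx hy => rw [inner_add_left, hx, hy, add_zero]
  | smul a x _ hx => rw [real_inner_smul_left, hx, mul_zero]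

lemma residualVariance_eq (hn : 0 < n) (h : IsUnit (gram X)) (y : EuclideanSpace ℝ (Fin n)) :
    residualVariance X y = ‖(colSpan X)ᗮ.starProjection y‖ ^ 2 / ((n : ℝ) - p) := by
  rw [residualVariance, fit_eq_fitL, fitL_betaTilde hn h, Submodule.starProjection_orthogonal_val]

/-- The divergence of `μ̂ = X β̂`, through the line derivatives of `β̂`. -/
noncomputable def divHat (X : Matrix (Fin n) (Fin p) ℝ) (ρ : ℝ → ℝ)
    (y : EuclideanSpace ℝ (Fin n)) : ℝ :=
  ∑ j, lineDeriv ℝ (fun y => betaHat X ρ y j) y (colVec X j)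

lemma _root_.LipschitzWith.euclidean_apply {E : Type*} [PseudoEMetricSpace E] {K : ℝ≥0}
    {f : E → EuclideanSpace ℝ (Fin p)} (hf : LipschitzWith K f) (j : Fin p) :
    LipschitzWith K fun y => f y j := by
  have h : LipschitzWith 1 fun b : EuclideanSpace ℝ (Fin p) => b j := LipschitzWith.of_dist_le_mul
    fun x y => by
      rw [NNReal.coe_one, one_mul, dist_eq_norm, dist_eq_norm]
      exact PiLp.norm_apply_le (x - y) j
  have := h.comp hf
  rwa [one_mul] at this

/-- The divergence is a measurable, bounded stand-in for `df̂`, which involves the unrestricted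
values of `ρ₂` at kinks. -/
lemma measurable_divHat {K : ℝ≥0} (hK : LipschitzWith K (betaHat X ρ)) :
    Measurable (divHat X ρ) :=
  Finset.measurable_sum _ fun j _ => measurable_lineDeriv (hK.euclidean_apply j).continuous

lemma norm_divHat_le {K : ℝ≥0} (hK : LipschitzWith K (betaHat X ρ))
    (y : EuclideanSpace ℝ (Fin n)) : ‖divHat X ρ y‖ ≤ ∑ j, K * ‖colVec X j‖ :=
  norm_sum_le_of_le _ fun j _ => norm_lineDeriv_le_of_lipschitz ℝ (hK.euclidean_apply j)

lemma IsPenalty.betaHat_eq_of_sub_mem (hρ : IsPenalty ρ ρ₂ lam) (hlam : 0 < lam)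
    (hk : ConcavityLE ρ k) (hc : GramGE X c) (hkc : k < c) {y y' : EuclideanSpace ℝ (Fin n)}
    (h : y - y' ∈ (colSpan X)ᗮ) : betaHat X ρ y = betaHat X ρ y' :=
  hρ.betaHat_eq_of_inner_eq hlam hk hc hkc fun b =>
    (colSpan X).inner_left_of_mem_orthogonal (fitL_mem_colSpan b) h

/-- Line derivatives are total, so the identity holds at every `y`, with no exceptional set to carry
through the independence argument. -/
lemma IsPenalty.divHat_eq_of_sub_mem (hρ : IsPenalty ρ ρ₂ lam) (hlam : 0 < lam)
    (hk : ConcavityLE ρ k) (hc : GramGE X c) (hkc : k < c) {y y' : EuclideanSpace ℝ (Fin n)}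
    (h : y - y' ∈ (colSpan X)ᗮ) : divHat X ρ y = divHat X ρ y' := by
  refine Finset.sum_congr rfl fun j _ => ?_
  simp only [lineDeriv]
  congr 1
  ext t
  rw [hρ.betaHat_eq_of_sub_mem hlam hk hc hkc
    (show y + t • colVec X j - (y' + t • colVec X j) ∈ (colSpan X)ᗮ by simpa using h)]

lemma IsPenalty.ae_dfHat_eq_divHat (hρ : IsPenalty ρ ρ₂ lam) (hlam : 0 < lam)
    (hk : ConcavityLE ρ k) (hc : GramGE X c) (hc0 : 0 ≤ c) (hkc : k < c) :
    ∀ᵐ y, dfHat X ρ ρ₂ y = divHat X ρ y := by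
  filter_upwards [hρ.ae_dfHat_eq hlam hk hc hc0 hkc] with y hy
  rw [hy.2]
  refine Finset.sum_congr rfl fun j _ => ?_
  have h : HasFDerivAt (fun y => betaHat X ρ y j)
      ((EuclideanSpace.proj j).comp (fderiv ℝ (betaHat X ρ) y)) y :=
    (EuclideanSpace.proj j : EuclideanSpace ℝ (Fin p) →L[ℝ] ℝ).hasFDerivAt.comp y hy.1.hasFDerivAt
  rw [h.differentiableAt.lineDeriv_eq_fderiv, h.fderiv]
  rfl

end ColumnSpace

end PenLSE

namespace PenLSE

open scoped RealInnerProductSpace ENNReal NNReal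

/-! ### Degrees of freedom and unbiased risk estimation -/

section Risk

variable {n p : ℕ} {X : Matrix (Fin n) (Fin p) ℝ} {ρ ρ₂ : ℝ → ℝ} {lam k c σ : ℝ} {K : ℝ≥0}
  {m : EuclideanSpace ℝ (Fin n)}

lemma lipschitzWith_betaHat_add (hK : LipschitzWith K (betaHat X ρ)) :
    LipschitzWith K fun x => betaHat X ρ (m + x) := by
  have := hK.comp (isometry_add_left m).lipschitz
  rwa [mul_one] at this

lemma exists_lipschitzWith_muHat_add (hK : LipschitzWith K (betaHat X ρ)) :
    ∃ K', LipschitzWith K' fun x => muHat X ρ (m + x) :=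
  ⟨_, (fitL X).lipschitz.comp (lipschitzWith_betaHat_add hK)⟩

lemma exists_lipschitzWith_muTilde_add :
    ∃ K', LipschitzWith K' fun x => muTilde X (m + x) :=
  ⟨_, (colSpan X).starProjection.lipschitz.comp (isometry_add_left m).lipschitz⟩

lemma memLp_muHat (hK : LipschitzWith K (betaHat X ρ)) :
    MemLp (fun x => muHat X ρ (m + x)) 2 (isoGaussian n σ) :=
  memLp_two_isoGaussian (exists_lipschitzWith_muHat_add hK).choose_spec

lemma memLp_muHat_apply (hK : LipschitzWith K (betaHat X ρ)) (i : Fin n) :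
    MemLp (fun x => muHat X ρ (m + x) i) 2 (isoGaussian n σ) :=
  memLp_two_isoGaussian ((exists_lipschitzWith_muHat_add hK).choose_spec.euclidean_apply i)

lemma memLp_muTilde_apply (i : Fin n) :
    MemLp (fun x => muTilde X (m + x) i) 2 (isoGaussian n σ) :=
  memLp_two_isoGaussian (exists_lipschitzWith_muTilde_add.choose_spec.euclidean_apply i)

lemma muTilde_add (hm : m ∈ colSpan X) (x : EuclideanSpace ℝ (Fin n)) :
    muTilde X (m + x) = m + (colSpan X).starProjection x := by
  rw [muTilde_eq, map_add, Submodule.starProjection_eq_self_iff.2 hm]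

lemma integrable_divHat (hK : LipschitzWith K (betaHat X ρ)) :
    Integrable (fun x => divHat X ρ (m + x)) (isoGaussian n σ) :=
  Integrable.of_bound ((measurable_divHat hK).comp (measurable_const_add m)).aestronglyMeasurable _
    (Eventually.of_forall fun _ => norm_divHat_le hK _)

lemma IsPenalty.ae_isoGaussian_dfHat_eq (hρ : IsPenalty ρ ρ₂ lam) (hlam : 0 < lam)
    (hk : ConcavityLE ρ k) (hc : GramGE X c) (hc0 : 0 ≤ c) (hkc : k < c) (hσ : 0 < σ) :
    ∀ᵐ x ∂(isoGaussian n σ), dfHat X ρ ρ₂ (m + x) = divHat X ρ (m + x) :=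
  (isoGaussian_absolutelyContinuous hσ).ae_le <|
    (quasiMeasurePreserving_add_left volume m).ae
      (hρ.ae_dfHat_eq_divHat (X := X) hlam hk hc hc0 hkc)

/-- Stein's identity for `μ̂`. -/
lemma integral_inner_muHat (hK : LipschitzWith K (betaHat X ρ)) (hσ : 0 < σ) :
    ∫ x, ⟪x, muHat X ρ (m + x)⟫ ∂(isoGaussian n σ) =
      σ ^ 2 * ∫ x, divHat X ρ (m + x) ∂(isoGaussian n σ) := by
  have hL : ∀ j, LipschitzWith K fun x => betaHat X ρ (m + x) j := fun j =>
    (lipschitzWith_betaHat_add hK).euclidean_apply j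
  have h1 : ∀ x, ⟪x, muHat X ρ (m + x)⟫ = ∑ j, ⟪x, colVec X j⟫ * betaHat X ρ (m + x) j := by
    intro x
    rw [muHat, fit_eq_fitL, fitL_eq_sum, inner_sum]
    exact Finset.sum_congr rfl fun j _ => by rw [real_inner_smul_right, mul_comm]
  have h2 : ∀ x, divHat X ρ (m + x) =
      ∑ j, lineDeriv ℝ (fun x => betaHat X ρ (m + x) j) x (colVec X j) := by
    intro x
    refine Finset.sum_congr rfl fun j _ => ?_
    simp only [lineDeriv, add_assoc]
  simp only [h1, h2]
  rw [integral_finsetSum, integral_finsetSum, Finset.mul_sum]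
  · exact Finset.sum_congr rfl fun j _ => integral_inner_mul_isoGaussian hσ (hL j) _
  · intro j _
    exact Integrable.of_bound (measurable_lineDeriv (hL j).continuous).aestronglyMeasurable _
      (Eventually.of_forall fun x => norm_lineDeriv_le_of_lipschitz ℝ (hL j))
  · intro j _
    exact (memLp_two_isoGaussian (lipschitzWith_inner_left _)).integrable_mul
      (memLp_two_isoGaussian (hL j))

lemma muHat_mem_colSpan (y : EuclideanSpace ℝ (Fin n)) : muHat X ρ y ∈ colSpan X :=
  fitL_mem_colSpan _

lemma inner_starProjection_muHat (x y : EuclideanSpace ℝ (Fin n)) :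
    ⟪(colSpan X).starProjection x, muHat X ρ y⟫ = ⟪x, muHat X ρ y⟫ := by
  rw [Submodule.inner_starProjection_left_eq_right,
    Submodule.starProjection_eq_self_iff.2 (muHat_mem_colSpan y)]

lemma integral_starProjection_apply (hσ : 0 < σ) (U : Submodule ℝ (EuclideanSpace ℝ (Fin n)))
    (i : Fin n) : ∫ x, U.starProjection x i ∂(isoGaussian n σ) = 0 := by
  rw [← integral_inner_isoGaussian hσ (U.starProjection (EuclideanSpace.single i 1))]
  congr 1
  ext x
  rw [← Submodule.inner_starProjection_left_eq_right, real_inner_comm,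
    EuclideanSpace.inner_single_left]
  simp

lemma memLp_starProjection_apply (U : Submodule ℝ (EuclideanSpace ℝ (Fin n))) (i : Fin n) :
    MemLp (fun x => U.starProjection x i) 2 (isoGaussian n σ) :=
  memLp_two_isoGaussian (U.starProjection.lipschitz.euclidean_apply i)

/-- The covariance form of the degrees of freedom, as an expected divergence. -/
lemma sum_covariance_eq (hK : LipschitzWith K (betaHat X ρ)) (hσ : 0 < σ)
    (hm : m ∈ colSpan X) :
    ∑ i, cov[fun x => muTilde X (m + x) i, fun x => muHat X ρ (m + x) i; isoGaussian n σ] / σ ^ 2 =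
      ∫ x, divHat X ρ (m + x) ∂(isoGaussian n σ) := by
  have h1 : ∀ i, cov[fun x => muTilde X (m + x) i, fun x => muHat X ρ (m + x) i;
      isoGaussian n σ] = ∫ x, (colSpan X).starProjection x i * muHat X ρ (m + x) i
        ∂(isoGaussian n σ) := by
    intro i
    have h2 := memLp_starProjection_apply (σ := σ) (colSpan X) i
    simp only [muTilde_add hm, PiLp.add_apply]
    -- The mean of `μ̃` drops out and the projected noise is centered, so the covariance is a plain
    -- expectation of a product.
    rw [covariance_const_add_left (h2.integrable one_le_two),
      covariance_eq_sub h2 (memLp_muHat_apply hK i), integral_starProjection_apply hσ, zero_mul,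
      sub_zero]
    rfl
  have hσ2 : σ ^ 2 ≠ 0 := by positivity
  rw [← Finset.sum_div, div_eq_iff hσ2, mul_comm, ← integral_inner_muHat hK hσ]
  simp only [h1]
  rw [← integral_finsetSum]
  · congr 1
    ext x
    rw [← inner_starProjection_muHat, PiLp.inner_apply]
    simp [mul_comm]
  · intro i _
    exact (memLp_starProjection_apply (colSpan X) i).integrable_mul (memLp_muHat_apply hK i)

lemma integrable_norm_sq_of_memLp {f : EuclideanSpace ℝ (Fin n) → EuclideanSpace ℝ (Fin n)}
    (hf : MemLp f 2 (isoGaussian n σ)) : Integrable (fun x => ‖f x‖ ^ 2) (isoGaussian n σ) :=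
  hf.integrable_norm_pow two_ne_zero

lemma memLp_starProjection (U : Submodule ℝ (EuclideanSpace ℝ (Fin n))) :
    MemLp (fun x => U.starProjection x) 2 (isoGaussian n σ) :=
  memLp_two_isoGaussian U.starProjection.lipschitz

lemma memLp_muTilde_sub_muHat (hK : LipschitzWith K (betaHat X ρ)) :
    MemLp (fun x => muTilde X (m + x) - muHat X ρ (m + x)) 2 (isoGaussian n σ) :=
  (memLp_two_isoGaussian exists_lipschitzWith_muTilde_add.choose_spec).sub (memLp_muHat hK)

lemma integrable_norm_sq_muHat_sub (hK : LipschitzWith K (betaHat X ρ)) :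
    Integrable (fun x => ‖muHat X ρ (m + x) - m‖ ^ 2) (isoGaussian n σ) :=
  integrable_norm_sq_of_memLp ((memLp_muHat hK).sub (memLp_const m))

/-- The decomposition of the risk of `μ̂`. -/
lemma integral_norm_sq_muHat_sub (hK : LipschitzWith K (betaHat X ρ)) (hσ : 0 < σ)
    (hm : m ∈ colSpan X) :
    ∫ x, ‖muHat X ρ (m + x) - m‖ ^ 2 ∂(isoGaussian n σ) =
      ∫ x, ‖muTilde X (m + x) - muHat X ρ (m + x)‖ ^ 2 ∂(isoGaussian n σ) +
        σ ^ 2 * (2 * ∫ x, divHat X ρ (m + x) ∂(isoGaussian n σ) - X.rank) := by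
  set P := (colSpan X).starProjection
  have h1 : ∀ x, ‖muHat X ρ (m + x) - m‖ ^ 2 =
      ‖muTilde X (m + x) - muHat X ρ (m + x)‖ ^ 2 +
        (2 * ⟪x, muHat X ρ (m + x)⟫ - 2 * ⟪x, m⟫ - ‖P x‖ ^ 2) := by
    intro x
    have h2 : muHat X ρ (m + x) - m = (muHat X ρ (m + x) - muTilde X (m + x)) + P x := by
      rw [muTilde_add hm]; abel
    have h3 : ⟪P x, m⟫ = ⟪x, m⟫ := by
      rw [Submodule.inner_starProjection_left_eq_right, Submodule.starProjection_eq_self_iff.2 hm]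
    rw [h2, norm_add_sq_real, norm_sub_rev, inner_sub_left, muTilde_add hm, inner_add_left,
      real_inner_self_eq_norm_sq, real_inner_comm (P x) (muHat X ρ (m + x)),
      inner_starProjection_muHat, real_inner_comm (P x) m, h3]
    ring
  have i1 := integrable_norm_sq_of_memLp (memLp_muTilde_sub_muHat (m := m) (σ := σ) hK)
  have i2 : Integrable (fun x => ⟪x, muHat X ρ (m + x)⟫) (isoGaussian n σ) := by
    have h2 : ∀ x : EuclideanSpace ℝ (Fin n), ⟪x, muHat X ρ (m + x)⟫ =
        ∑ i, P x i * muHat X ρ (m + x) i := by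
      intro x
      rw [← inner_starProjection_muHat, PiLp.inner_apply]
      simp [P, mul_comm]
    simp only [h2]
    exact integrable_finsetSum _ fun i _ =>
      (memLp_starProjection_apply (colSpan X) i).integrable_mul (memLp_muHat_apply hK i)
  have i3 : Integrable (fun x => ⟪x, m⟫) (isoGaussian n σ) :=
    (memLp_two_isoGaussian (lipschitzWith_inner_left m)).integrable one_le_two
  have i4 := integrable_norm_sq_of_memLp (memLp_starProjection (σ := σ) (colSpan X))
  have i5 : Integrable (fun x => 2 * ⟪x, muHat X ρ (m + x)⟫ - 2 * ⟪x, m⟫) (isoGaussian n σ) :=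
    (i2.const_mul 2).sub (i3.const_mul 2)
  have i6 : Integrable (fun x => 2 * ⟪x, muHat X ρ (m + x)⟫ - 2 * ⟪x, m⟫ - ‖P x‖ ^ 2)
      (isoGaussian n σ) := i5.sub i4
  simp only [h1]
  rw [integral_add i1 i6, integral_sub i5 i4,
    integral_sub (i2.const_mul 2) (i3.const_mul 2), integral_const_mul, integral_const_mul,
    integral_inner_muHat hK hσ, integral_inner_isoGaussian hσ,
    integral_norm_sq_starProjection hσ, finrank_colSpan]
  ring

/-- The mean residual squares are unbiased for the variance and independent of `df̂`. -/
lemma IsPenalty.integral_residualVariance_mul (hρ : IsPenalty ρ ρ₂ lam) (hlam : 0 < lam)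
    (hk : ConcavityLE ρ k) (hc : GramGE X c) (hkc : k < c) (hK : LipschitzWith K (betaHat X ρ))
    (hσ : 0 < σ) (hm : m ∈ colSpan X) (hpn : p < n) (hX : IsUnit (gram X)) :
    Integrable (fun x => residualVariance X (m + x) * (2 * divHat X ρ (m + x) - X.rank))
        (isoGaussian n σ) ∧
      ∫ x, residualVariance X (m + x) * (2 * divHat X ρ (m + x) - X.rank) ∂(isoGaussian n σ) =
        σ ^ 2 * (2 * ∫ x, divHat X ρ (m + x) ∂(isoGaussian n σ) - X.rank) := by
  set U := colSpan X with hU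
  have hn : 0 < n := by omega
  have hnp : (0 : ℝ) < (n : ℝ) - p := by
    rw [sub_pos]; exact_mod_cast hpn
  let s : EuclideanSpace ℝ (Fin n) → ℝ := fun z => ‖z‖ ^ 2 / ((n : ℝ) - p)
  let d : EuclideanSpace ℝ (Fin n) → ℝ := fun z => 2 * divHat X ρ (m + z) - X.rank
  have hs : ∀ x, residualVariance X (m + x) = s (Uᗮ.starProjection x) := by
    intro x
    rw [residualVariance_eq hn hX, map_add,
      (Uᗮ.starProjection_apply_eq_zero_iff).2 (Submodule.le_orthogonal_orthogonal U hm), zero_add]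
  have hd : ∀ x, 2 * divHat X ρ (m + x) - X.rank = d (U.starProjection x) := by
    intro x
    simp only [d]
    rw [hρ.divHat_eq_of_sub_mem hlam hk hc hkc (y := m + x) (y' := m + U.starProjection x)]
    rw [add_sub_add_left_eq_sub]
    exact U.sub_starProjection_mem_orthogonal x
  have hsm : Measurable s := by fun_prop
  have hdm : Measurable d :=
    (((measurable_divHat hK).comp (measurable_const_add m)).const_mul 2).sub_const _
  have hind : IndepFun (fun x => s (Uᗮ.starProjection x)) (fun x => d (U.starProjection x))
      (isoGaussian n σ) := (indepFun_starProjection σ U).symm.comp hsm hdm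
  have hsi : Integrable (fun x => s (Uᗮ.starProjection x)) (isoGaussian n σ) :=
    (integrable_norm_sq_of_memLp (memLp_starProjection Uᗮ)).div_const _
  have hdi : Integrable (fun x => d (U.starProjection x)) (isoGaussian n σ) := by
    simp only [← hd]
    exact ((integrable_divHat hK).const_mul 2).sub (integrable_const _)
  have hsI : ∫ x, s (Uᗮ.starProjection x) ∂(isoGaussian n σ) = σ ^ 2 := by
    simp only [s]
    rw [integral_div, integral_norm_sq_starProjection hσ]
    -- Invertibility of the Gram matrix gives `U` dimension `p`, so the divisor `n - p` is exactly
    -- the dimension of the residual space.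
    have h1 := U.finrank_add_finrank_orthogonal
    rw [finrank_colSpan, rank_eq_of_isUnit_gram hX, finrank_euclideanSpace_fin] at h1
    have h2 : (Module.finrank ℝ Uᗮ : ℝ) = (n : ℝ) - p := by
      have h3 : (p : ℝ) + Module.finrank ℝ Uᗮ = n := by exact_mod_cast h1
      linarith
    rw [h2, mul_div_assoc, div_self hnp.ne', mul_one]
  constructor
  · simp only [hs, hd]
    exact hind.integrable_mul hsi hdi
  · have h1 : ∫ x, d (U.starProjection x) ∂(isoGaussian n σ) =
        2 * ∫ x, divHat X ρ (m + x) ∂(isoGaussian n σ) - X.rank := by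
      simp only [← hd]
      rw [integral_sub ((integrable_divHat hK).const_mul 2) (integrable_const _),
        integral_const_mul]
      simp
    simp only [hs, hd]
    rw [hind.integral_fun_mul_eq_mul_integral hsi.aestronglyMeasurable hdi.aestronglyMeasurable,
      hsI, h1]

/-- `Ĉ_p` is an unbiased estimator of the risk of `μ̂`. -/
lemma IsPenalty.integral_cpHat (hρ : IsPenalty ρ ρ₂ lam) (hlam : 0 < lam)
    (hk : ConcavityLE ρ k) (hc : GramGE X c) (hc0 : 0 ≤ c) (hkc : k < c) (hσ : 0 < σ)
    (hm : m ∈ colSpan X) {s : EuclideanSpace ℝ (Fin n) → ℝ}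
    (hs : (s = fun _ => σ ^ 2) ∨ (p < n ∧ IsUnit (gram X) ∧ s = residualVariance X)) :
    Integrable (fun x => cpHat X ρ ρ₂ s (m + x)) (isoGaussian n σ) ∧
      ∫ x, cpHat X ρ ρ₂ s (m + x) ∂(isoGaussian n σ) =
        ∫ x, ‖muHat X ρ (m + x) - m‖ ^ 2 ∂(isoGaussian n σ) := by
  obtain ⟨K, hK⟩ := hρ.exists_lipschitzWith_betaHat (X := X) hlam hk hc hkc
  have hae : (fun x => cpHat X ρ ρ₂ s (m + x)) =ᵐ[isoGaussian n σ] fun x =>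
      ‖muTilde X (m + x) - muHat X ρ (m + x)‖ ^ 2 +
        s (m + x) * (2 * divHat X ρ (m + x) - X.rank) := by
    filter_upwards [hρ.ae_isoGaussian_dfHat_eq (X := X) (m := m) hlam hk hc hc0 hkc hσ] with x hx
    rw [cpHat, hx]
  have h1 : Integrable (fun x => s (m + x) * (2 * divHat X ρ (m + x) - X.rank))
        (isoGaussian n σ) ∧
      ∫ x, s (m + x) * (2 * divHat X ρ (m + x) - X.rank) ∂(isoGaussian n σ) =
        σ ^ 2 * (2 * ∫ x, divHat X ρ (m + x) ∂(isoGaussian n σ) - X.rank) := by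
    rcases hs with rfl | ⟨hpn, hX, rfl⟩
    · refine ⟨(((integrable_divHat hK).const_mul 2).sub (integrable_const _)).const_mul _, ?_⟩
      rw [integral_const_mul,
        integral_sub ((integrable_divHat hK).const_mul 2) (integrable_const _),
        integral_const_mul]
      simp
    · exact hρ.integral_residualVariance_mul hlam hk hc hkc hK hσ hm hpn hX
  have i1 := integrable_norm_sq_of_memLp (memLp_muTilde_sub_muHat (m := m) (σ := σ) hK)
  refine ⟨(integrable_congr hae).2 (i1.add h1.1), ?_⟩
  rw [integral_congr_ae hae, integral_add i1 h1.1, h1.2, integral_norm_sq_muHat_sub hK hσ hm]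

end Risk

/-! ### Penalties with locally constant slope -/

section Selection

variable {ρ ρ₂ : ℝ → ℝ} {lam k : ℝ}

lemma IsPenalty.second_deriv_eq_zero (hρ : IsPenalty ρ ρ₂ lam) {a t : ℝ} (ht : 0 < t)
    (h : deriv ρ =ᶠ[𝓝 t] fun _ => a) : ρ₂ t = 0 := by
  have h1 : HasDerivAt (deriv ρ) 0 t := (hasDerivAt_const t a).congr_of_eventuallyEq h
  rw [hρ.second_deriv t ht h1.differentiableAt, h1.deriv]

lemma deriv_eventuallyEq_of_linear (h : ∀ t, 0 ≤ t → ρ t = lam * t) {t : ℝ} (ht : 0 < t) :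
    deriv ρ =ᶠ[𝓝 t] fun _ => lam := by
  filter_upwards [Ioi_mem_nhds ht] with s hs
  have h1 : HasDerivAt ρ lam s := by
    have h2 := (hasDerivAt_id s).const_mul lam
    rw [mul_one] at h2
    refine h2.congr_of_eventuallyEq ?_
    filter_upwards [Ioi_mem_nhds hs] with r hr
    exact h r (mem_Ioi.1 hr).le
  exact h1.deriv

/-- With `k ≥ 0`, the bound `k < c` yields `c > 0`, which is what invertibility of the sub-Gram
matrices requires. -/
lemma ConcavityLE.nonneg_of_linear (hk : ConcavityLE ρ k)
    (h : ∀ t, 0 ≤ t → ρ t = lam * t) : 0 ≤ k := by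
  have h1 := hk 1 2 one_pos one_lt_two
  rw [(deriv_eventuallyEq_of_linear h one_pos).eq_of_nhds,
    (deriv_eventuallyEq_of_linear h two_pos).eq_of_nhds] at h1
  linarith

/-- The slope is flat beyond `γ * lam`, so two points there already force `0 ≤ k`. -/
lemma ConcavityLE.nonneg_of_isUnbiasedSelection (hk : ConcavityLE ρ k) {γ : ℝ}
    (hγ : 0 < γ) (hlam : 0 < lam) (h : IsUnbiasedSelection ρ γ lam) : 0 ≤ k := by
  have hpos : 0 < γ * lam := mul_pos hγ hlam
  have h1 := hk (γ * lam) (γ * lam + 1) hpos (by linarith)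
  rw [h.1 _ le_rfl, h.1 _ (by linarith)] at h1
  linarith

end Selection

end PenLSE

namespace PenLSE

open scoped NNReal

/-! ### Transfer to the probability space and the main theorem -/

section Model

variable {n p : ℕ} {X : Matrix (Fin n) (Fin p) ℝ} {ρ ρ₂ : ℝ → ℝ} {lam k c σ : ℝ}
  {Ω : Type*} [MeasurableSpace Ω] {P : Measure Ω} {ε : Ω → EuclideanSpace ℝ (Fin n)}

lemma integral_comp_of_hasLaw (hε : HasLaw ε (isoGaussian n σ) P)
    {f : EuclideanSpace ℝ (Fin n) → ℝ} (hf : Integrable f (isoGaussian n σ)) :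
    ∫ ω, f (ε ω) ∂P = ∫ x, f x ∂(isoGaussian n σ) :=
  hε.integral_comp hf.aestronglyMeasurable

lemma memLp_comp_of_hasLaw (hε : HasLaw ε (isoGaussian n σ) P)
    {f : EuclideanSpace ℝ (Fin n) → ℝ} {q : ENNReal} (hf : MemLp f q (isoGaussian n σ)) :
    MemLp (fun ω => f (ε ω)) q P := by
  rw [← hε.map_eq] at hf
  exact hf.comp_of_map hε.aemeasurable

lemma integrable_comp_of_hasLaw (hε : HasLaw ε (isoGaussian n σ) P)
    {f : EuclideanSpace ℝ (Fin n) → ℝ} (hf : Integrable f (isoGaussian n σ)) :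
    Integrable (fun ω => f (ε ω)) P := by
  rw [← hε.map_eq] at hf
  exact hf.comp_aemeasurable hε.aemeasurable

end Model

end PenLSE

theorem theorem8 {n p : ℕ} (X : Matrix (Fin n) (Fin p) ℝ) (ρ ρ₂ : ℝ → ℝ) (lam : ℝ)
    (hlam : 0 < lam) (hρ : PenLSE.IsPenalty ρ ρ₂ lam) (hconv : PenLSE.SparseConvex X ρ p) :
    -- the penalized loss has exactly one global minimizer, for every data vector
    (∀ (y : EuclideanSpace ℝ (Fin n)) (b : EuclideanSpace ℝ (Fin p)),
      IsMinOn (PenLSE.penLoss X ρ y) Set.univ b ↔ b = PenLSE.betaHat X ρ y) ∧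
    -- unbiasedness in the linear model `y = X β + ε`, `ε ∼ N(0, σ² I_n)`
    (∀ {Ω : Type*} [MeasurableSpace Ω] (P : Measure Ω) [IsProbabilityMeasure P]
      (β : EuclideanSpace ℝ (Fin p)) (σ : ℝ) (_ : 0 < σ)
      (ε y : Ω → EuclideanSpace ℝ (Fin n))
      (_ : HasLaw ε (multivariateGaussian 0 (σ ^ 2 • (1 : Matrix (Fin n) (Fin n) ℝ))) P)
      (_ : ∀ ω, y ω = PenLSE.fit X β + ε ω),
      -- all the moments exist
      (∀ i, MemLp (fun ω => PenLSE.muTilde X (y ω) i) 2 P ∧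
        MemLp (fun ω => PenLSE.muHat X ρ (y ω) i) 2 P) ∧
      Integrable (fun ω => PenLSE.dfHat X ρ ρ₂ (y ω)) P ∧
      Integrable (fun ω => ‖PenLSE.muHat X ρ (y ω) - PenLSE.fit X β‖ ^ 2) P ∧
      -- `E df̂ = df(μ̂)`
      ∫ ω, PenLSE.dfHat X ρ ρ₂ (y ω) ∂P = PenLSE.degreesOfFreedom P X ρ σ y ∧
      -- `E Ĉ_p = E ‖μ̂ - μ‖²`, for `σ̂² = σ²` and for the mean residual squares; in the second case
      -- `Σ` has to be invertible for the ordinary least squares estimator to be defined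
      ∀ s : EuclideanSpace ℝ (Fin n) → ℝ,
        ((s = fun _ => σ ^ 2) ∨
          (p < n ∧ IsUnit (PenLSE.gram X) ∧ s = PenLSE.residualVariance X)) →
        Integrable (fun ω => PenLSE.cpHat X ρ ρ₂ s (y ω)) P ∧
        ∫ ω, PenLSE.cpHat X ρ ρ₂ s (y ω) ∂P =
          ∫ ω, ‖PenLSE.muHat X ρ (y ω) - PenLSE.fit X β‖ ^ 2 ∂P) ∧
    -- `df̂ = #{j : β̂_j ≠ 0}` for the LASSO
    ((∀ t, 0 ≤ t → ρ t = lam * t) → ∀ y : EuclideanSpace ℝ (Fin n),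
      PenLSE.dfHat X ρ ρ₂ y = (Set.ncard {j | PenLSE.betaHat X ρ y j ≠ 0} : ℝ)) ∧
    -- `df̂ = #{j : β̂_j ≠ 0}` when all the nonzero `|β̂_j|` exceed `γ lam`
    (∀ γ : ℝ, 0 < γ → PenLSE.IsUnbiasedSelection ρ γ lam → ∀ y : EuclideanSpace ℝ (Fin n),
      (∀ j, PenLSE.betaHat X ρ y j ≠ 0 → γ * lam < |PenLSE.betaHat X ρ y j|) →
      PenLSE.dfHat X ρ ρ₂ y = (Set.ncard {j | PenLSE.betaHat X ρ y j ≠ 0} : ℝ)) := by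
  obtain ⟨k, c, hk, hkc, hc0, hc⟩ := hconv.exists_bounds
  replace hk := PenLSE.concavityLE_of_maxConcavity_eq hk
  refine ⟨fun y b => hρ.isMinOn_iff hlam hk hc hkc y b, ?_, fun h y => ?_, fun γ hγ h y hy => ?_⟩
  · intro Ω _ P _ β σ hσ ε y hε hy
    obtain rfl : y = fun ω => PenLSE.fit X β + ε ω := funext hy
    obtain ⟨K, hK⟩ := hρ.exists_lipschitzWith_betaHat (X := X) hlam hk hc hkc
    have hm : PenLSE.fit X β ∈ PenLSE.colSpan X := PenLSE.fitL_mem_colSpan β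
    have hdf := hρ.ae_isoGaussian_dfHat_eq (X := X) (m := PenLSE.fit X β) hlam hk hc hc0 hkc hσ
    have hdfi := (integrable_congr hdf).2 (PenLSE.integrable_divHat hK)
    have hrisk := PenLSE.integrable_norm_sq_muHat_sub (m := PenLSE.fit X β) (σ := σ) hK
    refine ⟨fun i => ⟨PenLSE.memLp_comp_of_hasLaw hε (PenLSE.memLp_muTilde_apply i),
      PenLSE.memLp_comp_of_hasLaw hε (PenLSE.memLp_muHat_apply hK i)⟩,
      PenLSE.integrable_comp_of_hasLaw hε hdfi, PenLSE.integrable_comp_of_hasLaw hε hrisk, ?_, ?_⟩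
    · rw [PenLSE.integral_comp_of_hasLaw hε hdfi, integral_congr_ae hdf,
        ← PenLSE.sum_covariance_eq hK hσ hm, PenLSE.degreesOfFreedom]
      refine Finset.sum_congr rfl fun i _ => ?_
      congr 1
      exact (hε.covariance_fun_comp
        (PenLSE.memLp_muTilde_apply i).aestronglyMeasurable.aemeasurable
        (PenLSE.memLp_muHat_apply hK i).aestronglyMeasurable.aemeasurable).symm
    · intro s hs
      obtain ⟨h1, h2⟩ := hρ.integral_cpHat hlam hk hc hc0 hkc hσ hm hs
      refine ⟨PenLSE.integrable_comp_of_hasLaw hε h1, ?_⟩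
      rw [PenLSE.integral_comp_of_hasLaw hε h1, h2, PenLSE.integral_comp_of_hasLaw hε hrisk]
  · exact PenLSE.dfHat_eq_ncard hc ((hk.nonneg_of_linear h).trans_lt hkc) fun j hj =>
      hρ.second_deriv_eq_zero (abs_pos.2 hj)
        (PenLSE.deriv_eventuallyEq_of_linear h (abs_pos.2 hj))
  · refine PenLSE.dfHat_eq_ncard hc
      ((hk.nonneg_of_isUnbiasedSelection hγ hlam h).trans_lt hkc) fun j hj =>
      hρ.second_deriv_eq_zero (a := 0) (abs_pos.2 hj) ?_
    -- The strict inequality leaves a whole neighbourhood of `|β̂_j|` on which the slope is zero,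
    -- excluding a possible kink at `γ * lam`.
    filter_upwards [Ioi_mem_nhds (hy j hj)] with t ht using h.1 t ht.le
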